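/- Fix $n\ge 2$ and let the letters be $1,\dots,n$. Let $B_\ell$ ($\ell\ge1$) be the $sl_n$ crystal of one-row semistandard tableaux $\alpha_1\le\dots\le\alpha_\ell$ (so $B_1$ is the set of single boxes), and $B_\natural$ the crystal of one-column semistandard tableaux $\binom{\alpha}{\beta}$, $\alpha<\beta$. Put $u_\ell=1\cdots1\in B_\ell$ and $u_\natural=\binom12\in B_\natural$. The crystal isomorphisms $\iota:B_\ell\otimes B_1\to B_1\otimes B_\ell$ and $\iota':B_\natural\otimes B_1\to B_1\otimes B_\natural$ are given explicitly as follows. $\iota$ sends $(\alpha_1\cdots\alpha_\ell)\otimes\beta$ to $d\otimes r$, where $r$ is the row obtained by replacing one letter $d$ by $\beta$ (and re-sorting), $d$ being the largest letter $\alpha_p<\beta$ if there is one and $d=\alpha_\ell$ otherwise. $\iota'$ sends $\binom{\alpha}{\beta}\otimes\gamma$ to $\alpha\otimes\binom{\gamma}{\beta}$ if $\gamma\le\alpha$, to $\beta\otimes\binom{\alpha}{\gamma}$ if $\alpha<\gamma\le\beta$, and to $\alpha\otimes\binom{\beta}{\gamma}$ if $\beta<\gamma$. A basic path is a sequence $p=p_1\otimes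 p_2\otimes\cdots$ of letters with $p_i=1$ for $i\gg1$. Applying $\iota$, respectively $\iota'$, successively at the positions $1,2,\dots$ defines maps $T_\ell$ and $T_\natural$ on basic paths by $$u_\ell\otimes p\mapsto T_\ell(p)\otimes u_\ell,\qquad u_\natural\otimes p\mapsto T_\natural(p)\otimes b(p),$$ where $b(p)\in B_\natural$, the final state of the carrier, contains a $1$. Let $T_\infty(p)$ be the path with which $T_\ell(p)$ agrees for all sufficiently large $\ell$. For a basic path $p$ and $N\ge0$ put $b_i(p,N)=b\big((T_\natural)^{N-i}(p)\big)$ for $1\le i\le N$, and let $\mathbf y(p,N)=y_1\cdots y_N$ be the word in which $y_i$ is the letter other than $1$ in $b_i(p,N)$. For basic paths $p,q$ and a word $\mathbf y$ of length $N$, write $p=q\oplus\mathbf y$ if $(T_\natural)^N(p)=q$, $q$ contains only the letters $1$ and $2$, and $\mathbf y(p,N)=\mathbf y$. Theorem. Let $\ell\in\{1,2,\dots\}\cup\{\infty\}$ and let $p$ be a basic path. (a) There is an $N\ge0$ such that both $(T_\natural)^N(p)$ and $(T_\natural)^N(T_\ell(p))$ contain only the letters $1$ and $2$. Moreover, for any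 basic path $q$, $(T_\natural)^N(q)$ is the same path for all $N$ for which it contains only the letters $1$ and $2$. (b) For every $N$ such that both $\tilde p:=(T_\natural)^N(p)$ and $\widetilde{T_\ell(p)}:=(T_\natural)^N(T_\ell(p))$ contain only the letters $1$ and $2$, one has $$T_\ell(\tilde p)=\widetilde{T_\ell(p)},\qquad b_i(p,N)=b_i(T_\ell(p),N)\quad(1\le i\le N).$$ Hence, with $\mathbf y=\mathbf y(p,N)$, both $p=\tilde p\oplus\mathbf y$ and $T_\ell(p)=T_\ell(\tilde p)\oplus\mathbf y$; that is, the colour word $\mathbf y$ is conserved. (c) $T_\ell(p)$ is constant in $\ell$ for all sufficiently large finite $\ell$ (so $T_\infty(p)$ is well defined), and $T_\infty=K_2K_3\cdots K_n$ (with $K_n$ acting first) is the time evolution of the coloured box-ball system, where $K_i$ moves every letter $i$ exactly once, taking the letters $i$ from left to right and exchanging each with its nearest $1$ on the right. -/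

import Mathlib

open Filter

/-! ### Letters, rows, dominoes -/

/-- The letters `1, …, n`; the letter `1` stands for an empty box. -/
abbrev Letter (n : ℕ) : Type := Set.Icc 1 n

/-- The index set `I = {1, …, n - 1}` of the Kashiwara operators. -/
abbrev CrystalIndex (n : ℕ) : Type := Set.Ico 1 n

/-- The index `i`, read as a letter. -/
def loLetter {n : ℕ} (i : CrystalIndex n) : Letter n := ⟨i.1, i.2.1, i.2.2.le⟩

/-- The letter `i + 1`. -/
def hiLetter {n : ℕ} (i : CrystalIndex n) : Letter n := ⟨i.1 + 1, Nat.le_add_left _ _, i.2.2⟩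

/-- The letter `1`. -/
def letterOne (n : ℕ) [h : n.AtLeastTwo] : Letter n := ⟨1, le_refl 1, by have := h.prop; omega⟩

/-- The letter `2`. -/
def letterTwo (n : ℕ) [h : n.AtLeastTwo] : Letter n := ⟨2, by omega, h.prop⟩

/-- `B_ℓ`: one-row semistandard tableaux of length `ℓ`. A weakly increasing row
`α₁ ≤ ⋯ ≤ α_ℓ` is the same thing as a multiset of `ℓ` letters. -/
abbrev Row (n ℓ : ℕ) : Type := Sym (Letter n) ℓ

/-- `B_♮`: one-column semistandard tableaux with two boxes `α < β`. -/
abbrev Domino (n : ℕ) : Type := {b : Letter n × Letter n // b.1 < b.2}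

/-! ### Crystals and tensor products -/

/-- The data of an `sl_n` crystal on a set `B`: the maps `f̃_i` (with `none` for `0`),
`φ_i` and `ε_i`. -/
structure CrystalOps (n : ℕ) (B : Type) where
  f : CrystalIndex n → B → Option B
  phi : CrystalIndex n → B → ℕ
  eps : CrystalIndex n → B → ℕ

/-- The row obtained by replacing one letter `a` of the row `x` by the letter `b`. -/
def Row.replace {n ℓ : ℕ} (x : Row n ℓ) (a b : Letter n) (h : a ∈ x.1) : Row n ℓ :=
  ⟨b ::ₘ x.1.erase a, by
    rw [Multiset.card_cons, ← Multiset.card_cons a, Multiset.cons_erase h]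
    exact x.2⟩

/-- The crystal `B_ℓ`: `f̃_i` replaces one letter `i` by `i + 1`. -/
def rowCrystal (n ℓ : ℕ) : CrystalOps n (Row n ℓ) where
  f i b := if h : loLetter i ∈ b.1 then some (b.replace (loLetter i) (hiLetter i) h) else none
  phi i b := b.1.count (loLetter i)
  eps i b := b.1.count (hiLetter i)

/-- The crystal `B_1`, a single box. -/
def boxCrystal (n : ℕ) : CrystalOps n (Letter n) where
  f i b := if b = loLetter i then some (hiLetter i) else none
  phi i b := if b = loLetter i then 1 else 0
  eps i b := if b = hiLetter i then 1 else 0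

/-- The domino with the given entries, provided that they are strictly increasing. -/
def mkDomino {n : ℕ} (α β : Letter n) : Option (Domino n) :=
  if h : α < β then some ⟨(α, β), h⟩ else none

/-- The crystal `B_♮`: `f̃_i` replaces `i` by `i + 1` if `i` appears and `i + 1` does not. -/
def dominoCrystal (n : ℕ) : CrystalOps n (Domino n) where
  f i b :=
    if b.1.1 = loLetter i ∧ b.1.2 ≠ hiLetter i then mkDomino (hiLetter i) b.1.2
    else if b.1.2 = loLetter i then mkDomino b.1.1 (hiLetter i)
    else none
  phi i b := if (b.1.1 = loLetter i ∨ b.1.2 = loLetter i) ∧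
      ¬(b.1.1 = hiLetter i ∨ b.1.2 = hiLetter i) then 1 else 0
  eps i b := if (b.1.1 = hiLetter i ∨ b.1.2 = hiLetter i) ∧
      ¬(b.1.1 = loLetter i ∨ b.1.2 = loLetter i) then 1 else 0

/-- The tensor product of two crystals; the underlying set is the product. -/
def CrystalOps.tensor {n : ℕ} {B B' : Type} (C : CrystalOps n B) (C' : CrystalOps n B') :
    CrystalOps n (B × B') where
  f i b := if C'.eps i b.2 < C.phi i b.1 then (C.f i b.1).map (fun x => (x, b.2))
    else (C'.f i b.2).map (fun x => (b.1, x))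
  phi i b := max (C'.phi i b.2) (C.phi i b.1 + C'.phi i b.2 - C'.eps i b.2)
  eps i b := max (C.eps i b.1) (C.eps i b.1 + C'.eps i b.2 - C.phi i b.1)

/-- Isomorphisms of `sl_n` crystals: bijections commuting with all `f̃_i`. -/
structure CrystalIso {n : ℕ} {B B' : Type} (C : CrystalOps n B) (C' : CrystalOps n B') where
  toFun : B → B'
  bijective : Function.Bijective toFun
  map_f : ∀ i b, C'.f i (toFun b) = (C.f i b).map toFun

/-! ### The isomorphism `ι : B_ℓ ⊗ B_1 ≃ B_1 ⊗ B_ℓ` -/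

/-- The letter that leaves the row `α₁ ≤ ⋯ ≤ α_ℓ` when `β` enters it: the largest `α_p < β`
if there is one, and otherwise `α_ℓ` (for an empty row, `β` itself). -/
def ejected {n : ℕ} (x : Multiset (Letter n)) (β : Letter n) : Letter n :=
  if h : (x.filter (· < β)).toFinset.Nonempty then (x.filter (· < β)).toFinset.max' h
  else (β ::ₘ x).toFinset.max' ⟨β, by simp⟩

theorem ejected_spec {n : ℕ} (x : Multiset (Letter n)) (β : Letter n) :
    (ejected x β ∈ x ∧ ejected x β < β ∧ ∀ a ∈ x, a < β → a ≤ ejected x β) ∨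
    ((∀ a ∈ x, β ≤ a) ∧ ejected x β ∈ β ::ₘ x ∧ ∀ a ∈ β ::ₘ x, a ≤ ejected x β) := by
  unfold ejected
  split_ifs with h
  · left
    have h1 := Finset.max'_mem _ h
    simp only [Multiset.mem_toFinset, Multiset.mem_filter] at h1
    refine ⟨h1.1, h1.2, fun a ha hb => Finset.le_max' _ _ ?_⟩
    simp [ha, hb]
  · right
    refine ⟨fun a ha => ?_, ?_, fun a ha => Finset.le_max' _ _ (by simpa using ha)⟩
    · by_contra hc
      exact h ⟨a, by simpa [ha] using hc⟩
    · have h1 := Finset.max'_mem (β ::ₘ x).toFinset ⟨β, by simp⟩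
      exact Multiset.mem_toFinset.1 h1

theorem ejected_mem {n : ℕ} (x : Multiset (Letter n)) (β : Letter n) :
    ejected x β ∈ β ::ₘ x := by
  rcases ejected_spec x β with h | h
  · exact Multiset.mem_cons_of_mem h.1
  · exact h.2.1

theorem ejected_eq {n : ℕ} {x : Multiset (Letter n)} {β d : Letter n}
    (h : (d ∈ x ∧ d < β ∧ ∀ a ∈ x, a < β → a ≤ d) ∨
      ((∀ a ∈ x, β ≤ a) ∧ d ∈ β ::ₘ x ∧ ∀ a ∈ β ::ₘ x, a ≤ d)) : ejected x β = d := by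
  rcases ejected_spec x β with h1 | h1 <;> rcases h with h2 | h2
  · exact le_antisymm (h2.2.2 _ h1.1 h1.2.1) (h1.2.2 _ h2.1 h2.2.1)
  · exact absurd (h2.1 _ h1.1) (not_le.2 h1.2.1)
  · exact absurd (h1.1 _ h2.1) (not_le.2 h2.2.1)
  · exact le_antisymm (h2.2.2 _ h1.2.1) (h1.2.2 _ h2.2.1)

/-- The explicit map `ι`: the new letter joins the row and one letter leaves it. -/
def iotaFun {n ℓ : ℕ} (b : Row n ℓ × Letter n) : Letter n × Row n ℓ :=
  (ejected b.1.1 b.2, ⟨(b.2 ::ₘ b.1.1).erase (ejected b.1.1 b.2), by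
    rw [Multiset.card_erase_of_mem (ejected_mem _ _), Multiset.card_cons, b.1.2]; rfl⟩)

theorem iotaFun_injective {n ℓ : ℕ} : Function.Injective (iotaFun (n := n) (ℓ := ℓ)) := by
  rintro ⟨x, β⟩ ⟨x', β'⟩ h
  have h1 : ejected x.1 β = ejected x'.1 β' := congrArg Prod.fst h
  have h2 : (β ::ₘ x.1).erase (ejected x.1 β) = (β' ::ₘ x'.1).erase (ejected x'.1 β') :=
    congrArg (fun q => q.2.1) h
  have hM : β ::ₘ x.1 = β' ::ₘ x'.1 := by
    rw [← Multiset.cons_erase (ejected_mem x.1 β), h2, h1,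
      Multiset.cons_erase (ejected_mem x'.1 β')]
  have hβ : β = β' := by
    have s := ejected_spec x.1 β
    have s' := ejected_spec x'.1 β'
    have e1 := Multiset.mem_cons_self β x.1
    have e2 := Multiset.mem_cons_self β' x'.1
    have g : ∀ a, a ∈ β ::ₘ x.1 ↔ a ∈ β' ::ₘ x'.1 := fun a => by rw [hM]
    rw [hM] at e1
    rw [← hM] at e2
    rw [Multiset.mem_cons] at e1 e2
    rw [← h1] at s'
    simp only [Multiset.mem_cons] at s s'
    grind
  subst hβ
  have hx : x = x' := Subtype.ext ((Multiset.cons_inj_right _).1 hM)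
  rw [hx]

theorem iotaFun_bijective {n ℓ : ℕ} : Function.Bijective (iotaFun (n := n) (ℓ := ℓ)) := by
  rw [Fintype.bijective_iff_injective_and_card]
  exact ⟨iotaFun_injective, by rw [Fintype.card_prod, Fintype.card_prod, mul_comm]⟩

theorem loLetter_lt {n : ℕ} (i : CrystalIndex n) : loLetter i < hiLetter i := by
  simp [loLetter, hiLetter, ← Subtype.coe_lt_coe]

theorem lt_hiLetter {n : ℕ} (i : CrystalIndex n) (c : Letter n) :
    c < hiLetter i ↔ c ≤ loLetter i := by
  simp only [loLetter, hiLetter, ← Subtype.coe_lt_coe, ← Subtype.coe_le_coe]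
  omega

theorem iotaFun_eq {n ℓ : ℕ} (x : Row n ℓ) (β d : Letter n) (y : Row n ℓ)
    (h1 : ejected x.1 β = d) (h2 : d ::ₘ y.1 = β ::ₘ x.1) : iotaFun (x, β) = (d, y) := by
  refine Prod.ext h1 (Subtype.ext ?_)
  change (β ::ₘ x.1).erase (ejected x.1 β) = y.1
  rw [h1, ← h2, Multiset.erase_cons_head]

set_option maxHeartbeats 2000000 in
theorem iotaFun_map_f {n ℓ : ℕ} (i : CrystalIndex n) (b : Row n ℓ × Letter n) :
    ((boxCrystal n).tensor (rowCrystal n ℓ)).f i (iotaFun b) =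
      (((rowCrystal n ℓ).tensor (boxCrystal n)).f i b).map iotaFun := by
  obtain ⟨x, β⟩ := b
  obtain ⟨d, y, hdy⟩ : ∃ d y, iotaFun (x, β) = (d, y) := ⟨_, _, rfl⟩
  have hd : ejected x.1 β = d := congrArg Prod.fst hdy
  have hM : d ::ₘ y.1 = β ::ₘ x.1 := by
    have : (β ::ₘ x.1).erase (ejected x.1 β) = y.1 := congrArg (fun q => q.2.1) hdy
    rw [← this, hd, Multiset.cons_erase]
    rw [← hd]
    exact ejected_mem _ _
  have hs := ejected_spec x.1 β
  rw [hd] at hs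
  rw [hdy]
  have hab := loLetter_lt i
  have hcov := lt_hiLetter i
  have mem : ∀ c, (c = d ∨ c ∈ y.1) ↔ (c = β ∨ c ∈ x.1) := fun c => by
    rw [← Multiset.mem_cons, ← Multiset.mem_cons, hM]
  have cnt : ∀ c, y.1.count c + (if c = d then 1 else 0) =
      x.1.count c + (if c = β then 1 else 0) := fun c => by
    rw [← Multiset.count_cons, ← Multiset.count_cons, hM]
  have cy : ∀ c, c ∈ y.1 ↔ 0 < y.1.count c := fun c => Multiset.count_pos.symm
  have cx : ∀ c, c ∈ x.1 ↔ 0 < x.1.count c := fun c => Multiset.count_pos.symm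
  simp only [CrystalOps.tensor, boxCrystal, rowCrystal]
  generalize loLetter i = a at *
  generalize hiLetter i = b at *
  simp only [Multiset.mem_cons] at hs
  have hcovβ := hcov β
  have hcovd := hcov d
  by_cases R1 : (if β = b then 1 else 0) < x.1.count a
  · rw [if_pos R1]
    have ha : a ∈ x.1 := (cx a).2 (by omega)
    rw [dif_pos ha]
    by_cases L1 : y.1.count b < (if d = a then 1 else 0)
    · rw [if_pos L1]
      have hda : d = a := by by_contra hc; simp [hc] at L1
      rw [if_pos hda]
      subst hda
      have hb : b ∉ y.1 := by rw [cy]; simpa using L1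
      simp only [Option.map_some]
      congr 1
      symm
      apply iotaFun_eq
      · apply ejected_eq
        have hsub : ∀ c ∈ x.1.erase d, c ∈ x.1 := fun c hc => Multiset.mem_of_mem_erase hc
        simp only [Row.replace, Multiset.mem_cons]
        grind
      · simp only [Row.replace]
        rw [← Multiset.cons_inj_right d, Multiset.cons_swap d b, hM,
          Multiset.cons_swap d β, Multiset.cons_swap d b, Multiset.cons_erase ha,
          Multiset.cons_swap]
    · rw [if_neg L1]
      have hay : a ∈ y.1 := by
        grind
      rw [dif_pos hay]
      simp only [Option.map_some]
      congr 1
      symm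
      apply iotaFun_eq
      · apply ejected_eq
        have hsub : ∀ c ∈ x.1.erase a, c ∈ x.1 := fun c hc => Multiset.mem_of_mem_erase hc
        have hsub2 : ∀ c ∈ x.1, c ≠ a → c ∈ x.1.erase a := fun c hc h =>
          (Multiset.mem_erase_of_ne h).2 hc
        have hself : a ∈ x.1.erase a ↔ 1 < x.1.count a := by
          rw [← Multiset.count_pos, Multiset.count_erase_self]; omega
        have hby : d = a → b ∈ y.1 := fun h => by rw [if_pos h] at L1; rw [cy]; omega
        have hR2 : β = b → 1 < x.1.count a := fun h => by rwa [if_pos h] at R1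
        have hbx : b ≠ d → b ≠ β → b ∈ y.1 → b ∈ x.1 := fun h1 h2 h => by
          have := mem b; tauto
        simp only [Row.replace, Multiset.mem_cons]
        rcases hs with ⟨h1, h2, h3⟩ | ⟨h1, h2, h3⟩
        · left
          have hadβ : a < β → a ≤ d := h3 a ha
          have hda : a < d → b ≤ d := fun h => not_lt.1 fun h' => not_le.2 h (hcovd.1 h')
          have key : β = b ∨ b < β ∨ β ≤ a := by
            rcases lt_trichotomy β b with h | h | h
            · exact Or.inr (Or.inr (hcovβ.1 h))
            · exact Or.inl h
            · exact Or.inr (Or.inl h)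
          refine ⟨?_, h2, ?_⟩
          · rcases eq_or_ne d a with h | h
            · subst h
              refine Or.inr (hself.2 ?_)
              rcases key with k | k | k
              · exact hR2 k
              · exact absurd (h3 b (hbx hab.ne' k.ne (hby rfl)) k) (not_le.2 hab)
              · exact absurd h2 (not_lt.2 k)
            · exact Or.inr (hsub2 d h1 h)
          · rintro c (rfl | hc) hcβ
            · rcases (hadβ (hab.trans hcβ)).lt_or_eq with h | h
              · exact hda h
              · exact h3 _ (hbx (h ▸ hab.ne') hcβ.ne (hby h.symm)) hcβ
            · exact h3 c (hsub c hc) hcβ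
        · right
          have hβa := h1 a ha
          have had := h3 a (Or.inr ha)
          have hbd : b ≤ d := by
            rcases had.lt_or_eq with h | h
            · exact not_lt.1 fun h' => not_le.2 h (hcovd.1 h')
            · have hb := hby h.symm
              exact h3 b ((mem b).1 (Or.inr hb))
          refine ⟨?_, ?_, ?_⟩
          · rintro c (rfl | hc)
            · exact hβa.trans hab.le
            · exact h1 c (hsub c hc)
          · rcases h2 with h | h
            · exact Or.inl h
            · exact Or.inr (Or.inr (hsub2 d h (hab.trans_le hbd).ne'))
          · rintro c (rfl | rfl | hc)
            · exact h3 _ (Or.inl rfl)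
            · exact hbd
            · exact h3 c (Or.inr (hsub c hc))
      · simp only [Row.replace]
        rw [← Multiset.cons_inj_right a, Multiset.cons_swap a d, Multiset.cons_swap a b,
          Multiset.cons_erase hay, Multiset.cons_swap a β, Multiset.cons_swap a b,
          Multiset.cons_erase ha, Multiset.cons_swap d b, hM, Multiset.cons_swap]
  · rw [if_neg R1]
    by_cases hβ : β = a
    · rw [if_pos hβ]
      subst hβ
      simp only [Option.map_some]
      by_cases L1 : y.1.count b < (if d = β then 1 else 0)
      · rw [if_pos L1]
        have hda : d = β := by by_contra hc; simp [hc] at L1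
        rw [if_pos hda]
        subst hda
        have hxy : y.1 = x.1 := (Multiset.cons_inj_right _).1 hM
        simp only [Option.map_some]
        congr 1
        symm
        apply iotaFun_eq
        · apply ejected_eq
          simp only [Multiset.mem_cons]
          grind
        · rw [hxy]
      · rw [if_neg L1]
        have hay : β ∈ y.1 := by
          grind
        rw [dif_pos hay]
        simp only [Option.map_some]
        congr 1
        symm
        apply iotaFun_eq
        · apply ejected_eq
          have hβx : β ∉ x.1 := by
            rw [if_neg hab.ne] at R1
            exact fun h => R1 ((cx β).1 h)
          simp only [Multiset.mem_cons]
          rcases hs with ⟨h1, h2, h3⟩ | ⟨h1, h2, h3⟩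
          · exact Or.inl ⟨h1, h2.trans hab, fun c hc hcb =>
              h3 c hc (lt_of_le_of_ne ((hcov c).1 hcb) fun h => hβx (h ▸ hc))⟩
          · right
            have hx : ∀ c ∈ x.1, b ≤ c := fun c hc => not_lt.1 fun h =>
              hβx (le_antisymm (h1 c hc) ((hcov c).1 h) ▸ hc)
            have hdx : d ∈ x.1 := by
              rcases h2 with h | h
              · subst h
                rw [if_pos rfl] at L1
                have hb : b ∈ y.1 := by rw [cy]; omega
                exact absurd (h3 b ((mem b).1 (Or.inr hb))) (not_le.2 hab)
              · exact h
            refine ⟨hx, Or.inr hdx, ?_⟩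
            rintro c (rfl | hc)
            · exact hx d hdx
            · exact h3 c (Or.inr hc)
        · simp only [Row.replace]
          rw [← Multiset.cons_inj_right β, Multiset.cons_swap β d, Multiset.cons_swap β b,
            Multiset.cons_erase hay, Multiset.cons_swap d b, hM, Multiset.cons_swap]
    · rw [if_neg hβ]
      simp only [Option.map_none]
      by_cases L1 : y.1.count b < (if d = a then 1 else 0)
      · grind
      · rw [if_neg L1]
        have hay : a ∉ y.1 := by
          grind
        rw [dif_neg hay]
        rfl

/-- `ι : B_ℓ ⊗ B_1 ≃ B_1 ⊗ B_ℓ` as an isomorphism of crystals. -/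
def iota (n ℓ : ℕ) :
    CrystalIso ((rowCrystal n ℓ).tensor (boxCrystal n))
      ((boxCrystal n).tensor (rowCrystal n ℓ)) where
  toFun := iotaFun
  bijective := iotaFun_bijective
  map_f := iotaFun_map_f

/-! ### The isomorphism `ι' : B_♮ ⊗ B_1 ≃ B_1 ⊗ B_♮` -/

/-- The explicit map `ι'`. -/
def iotaDominoFun {n : ℕ} (b : Domino n × Letter n) : Letter n × Domino n :=
  if h₁ : b.2 ≤ b.1.1.1 then (b.1.1.1, ⟨(b.2, b.1.1.2), lt_of_le_of_lt h₁ b.1.2⟩)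
  else if b.2 ≤ b.1.1.2 then (b.1.1.2, ⟨(b.1.1.1, b.2), not_le.1 h₁⟩)
  else if h₃ : b.1.1.2 < b.2 then (b.1.1.1, ⟨(b.1.1.2, b.2), h₃⟩)
  else (b.1.1.1, b.1)

theorem iotaDominoFun_injective {n : ℕ} : Function.Injective (iotaDominoFun (n := n)) := by
  rintro ⟨⟨⟨α, β⟩, h⟩, γ⟩ ⟨⟨⟨α', β'⟩, h'⟩, γ'⟩ e
  simp only [iotaDominoFun] at *
  grind

theorem iotaDominoFun_bijective {n : ℕ} : Function.Bijective (iotaDominoFun (n := n)) := by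
  rw [Fintype.bijective_iff_injective_and_card]
  exact ⟨iotaDominoFun_injective, by rw [Fintype.card_prod, Fintype.card_prod, mul_comm]⟩

set_option maxHeartbeats 2000000 in
theorem iotaDominoFun_map_f {n : ℕ} (i : CrystalIndex n) (b : Domino n × Letter n) :
    ((boxCrystal n).tensor (dominoCrystal n)).f i (iotaDominoFun b) =
      (((dominoCrystal n).tensor (boxCrystal n)).f i b).map iotaDominoFun := by
  obtain ⟨⟨⟨α, β⟩, h⟩, γ⟩ := b
  have hab := loLetter_lt i
  have hcov := lt_hiLetter i
  simp only [CrystalOps.tensor, boxCrystal, dominoCrystal, mkDomino]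
  unfold iotaDominoFun
  have h0 : α < β := h
  have hcovα := hcov α
  have hcovβ := hcov β
  have hcovγ := hcov γ
  rcases le_or_gt γ α with h1 | h1
  · simp only [h1, dif_pos]
    grind
  · rcases le_or_gt γ β with h2 | h2
    · simp only [not_le.2 h1, h2, if_pos]
      grind
    · simp only [not_le.2 h1, not_le.2 h2, h2, dif_pos]
      grind

/-- `ι' : B_♮ ⊗ B_1 ≃ B_1 ⊗ B_♮` as an isomorphism of crystals. -/
def iotaDomino (n : ℕ) :
    CrystalIso ((dominoCrystal n).tensor (boxCrystal n))
      ((boxCrystal n).tensor (dominoCrystal n)) where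
  toFun := iotaDominoFun
  bijective := iotaDominoFun_bijective
  map_f := iotaDominoFun_map_f

/-! ### Paths and their evolutions -/

/-- Basic paths `p₁ ⊗ p₂ ⊗ ⋯` with `p_i = 1` for `i ≫ 1`; the box `p_{i+1}` is `p.1 i`. -/
abbrev BasicPath (n : ℕ) [n.AtLeastTwo] : Type :=
  {p : ℕ → Letter n // ∀ᶠ i in atTop, p i = letterOne n}

/-- A carrier in state `c` is sent through the boxes `p 0, p 1, …` by the map
`R : C ⊗ B_1 → B_1 ⊗ C`; this is its state just before the box `p i`. -/
def carrierState {n : ℕ} {C : Type} (R : C × Letter n → Letter n × C) (c : C)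
    (p : ℕ → Letter n) : ℕ → C
  | 0 => c
  | i + 1 => (R (carrierState R c p i, p i)).2

/-- The boxes left behind by the carrier. -/
def carrierOutput {n : ℕ} {C : Type} (R : C × Letter n → Letter n × C) (c : C)
    (p : ℕ → Letter n) (i : ℕ) : Letter n :=
  (R (carrierState R c p i, p i)).1

/-- The highest weight element `u_ℓ = 1 ⋯ 1` of `B_ℓ`. -/
def highestRow (n ℓ : ℕ) [n.AtLeastTwo] : Row n ℓ := Sym.replicate ℓ (letterOne n)

/-- The highest weight element `u_♮` of `B_♮`, with entries `1 < 2`. -/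
def highestDomino (n : ℕ) [n.AtLeastTwo] : Domino n :=
  ⟨(letterOne n, letterTwo n), by simp [letterOne, letterTwo, ← Subtype.coe_lt_coe]⟩

theorem letterOne_le {n : ℕ} [n.AtLeastTwo] (a : Letter n) : letterOne n ≤ a := a.2.1

theorem count_iotaFun_one {n ℓ : ℕ} [n.AtLeastTwo] (x : Row n ℓ) :
    min ℓ (x.1.count (letterOne n) + 1) ≤
      (iotaFun (x, letterOne n)).2.1.count (letterOne n) := by
  change _ ≤ Multiset.count _ ((letterOne n ::ₘ x.1).erase (ejected x.1 (letterOne n)))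
  have hs := ejected_spec x.1 (letterOne n)
  have hm := ejected_mem x.1 (letterOne n)
  by_cases hd : ejected x.1 (letterOne n) = letterOne n
  · rw [hd, Multiset.erase_cons_head]
    rcases hs with h | h
    · exact absurd h.2.1 (not_lt.2 (letterOne_le _))
    · have hall : ∀ a ∈ x.1, letterOne n = a := fun a ha =>
        le_antisymm (letterOne_le a) (hd ▸ h.2.2 a (Multiset.mem_cons_of_mem ha))
      rw [Multiset.count_eq_card.2 hall, x.2]
      exact min_le_left _ _
  · rw [Multiset.count_erase_of_ne (Ne.symm hd), Multiset.count_cons_self]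
    exact min_le_right _ _

theorem row_eq_highest {n ℓ : ℕ} [n.AtLeastTwo] (x : Row n ℓ)
    (h : ℓ ≤ x.1.count (letterOne n)) : x = highestRow n ℓ := by
  apply Subtype.ext
  change x.1 = Multiset.replicate ℓ (letterOne n)
  have h1 : x.1.count (letterOne n) = x.1.card :=
    le_antisymm (Multiset.count_le_card _ _) (x.2.le.trans h)
  exact Multiset.eq_replicate.2 ⟨x.2, fun a ha => (Multiset.count_eq_card.1 h1 a ha).symm⟩

/-- In `u_ℓ ⊗ p ↦ T_ℓ(p) ⊗ c` the final carrier `c` is `u_ℓ`. -/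
theorem rowCarrier_eventually {n : ℕ} [n.AtLeastTwo] (ℓ : ℕ) (p : BasicPath n) :
    ∀ᶠ i in atTop,
      carrierState (iota n ℓ).toFun (highestRow n ℓ) p.1 i = highestRow n ℓ := by
  obtain ⟨F, hF⟩ := eventually_atTop.1 p.2
  have key : ∀ m, min ℓ m ≤ (carrierState (iota n ℓ).toFun (highestRow n ℓ) p.1
      (F + m)).1.count (letterOne n) := by
    intro m
    induction m with
    | zero => simp
    | succ m ih =>
      rw [← Nat.add_assoc, carrierState, hF (F + m) (Nat.le_add_right _ _)]
      have := count_iotaFun_one (carrierState (iota n ℓ).toFun (highestRow n ℓ) p.1 (F + m))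
      change _ ≤ (iotaFun _).2.1.count _
      omega
  refine eventually_atTop.2 ⟨F + ℓ, fun i hi => row_eq_highest _ ?_⟩
  have h := key (i - F)
  rw [Nat.add_sub_cancel' (by omega)] at h
  omega

theorem rowOutput_eventually {n : ℕ} [n.AtLeastTwo] (ℓ : ℕ) (p : BasicPath n) :
    ∀ᶠ i in atTop,
      carrierOutput (iota n ℓ).toFun (highestRow n ℓ) p.1 i = letterOne n := by
  filter_upwards [rowCarrier_eventually ℓ p, p.2] with i h1 h2
  rw [carrierOutput, h1, h2]
  have h := ejected_mem (highestRow n ℓ).1 (letterOne n)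
  change ejected (highestRow n ℓ).1 (letterOne n) = letterOne n
  rcases Multiset.mem_cons.1 h with h | h
  · exact h
  · exact Multiset.eq_of_mem_replicate h

/-- `T_ℓ`, defined by `u_ℓ ⊗ p ↦ T_ℓ(p) ⊗ u_ℓ`. -/
def rowEvolution {n : ℕ} [n.AtLeastTwo] (ℓ : ℕ) (p : BasicPath n) : BasicPath n :=
  ⟨carrierOutput (iota n ℓ).toFun (highestRow n ℓ) p.1, rowOutput_eventually ℓ p⟩

theorem iotaDominoFun_one {n : ℕ} [n.AtLeastTwo] (b : Domino n) :
    (iotaDominoFun (b, letterOne n)).1 = b.1.1 ∧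
    (iotaDominoFun (b, letterOne n)).2.1 = (letterOne n, b.1.2) := by
  unfold iotaDominoFun
  rw [dif_pos (letterOne_le _)]
  exact ⟨rfl, rfl⟩

theorem dominoCarrier_eventually {n : ℕ} [n.AtLeastTwo] (p : BasicPath n) :
    ∃ b : Domino n, b.1.1 = letterOne n ∧ ∀ᶠ i in atTop,
      carrierState (iotaDomino n).toFun (highestDomino n) p.1 i = b := by
  obtain ⟨F, hF⟩ := eventually_atTop.1 p.2
  have step : ∀ i, F ≤ i →
      (carrierState (iotaDomino n).toFun (highestDomino n) p.1 (i + 1)).1 =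
        (letterOne n, (carrierState (iotaDomino n).toFun (highestDomino n) p.1 i).1.2) := by
    intro i hi
    rw [carrierState, hF i hi]
    exact (iotaDominoFun_one _).2
  refine ⟨carrierState (iotaDomino n).toFun (highestDomino n) p.1 (F + 1), ?_, ?_⟩
  · rw [step F le_rfl]
  · refine eventually_atTop.2 ⟨F + 1, fun i hi => ?_⟩
    induction i, hi using Nat.le_induction with
    | base => rfl
    | succ i hi ih =>
      apply Subtype.ext
      rw [step i (by omega), ih, step F le_rfl]

/-- The outgoing carrier `b(p)` in `u_♮ ⊗ p ↦ T_♮(p) ⊗ b(p)`. -/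
noncomputable def outgoing {n : ℕ} [n.AtLeastTwo] (p : BasicPath n) : Domino n :=
  (dominoCarrier_eventually p).choose

/-- `b(p)` contains a `1`, and it is the state of the carrier far to the right. -/
theorem outgoing_spec {n : ℕ} [n.AtLeastTwo] (p : BasicPath n) :
    (outgoing p).1.1 = letterOne n ∧ ∀ᶠ i in atTop,
      carrierState (iotaDomino n).toFun (highestDomino n) p.1 i = outgoing p :=
  (dominoCarrier_eventually p).choose_spec

/-- `T_♮`, defined by `u_♮ ⊗ p ↦ T_♮(p) ⊗ b(p)`. -/
def dominoEvolution {n : ℕ} [n.AtLeastTwo] (p : BasicPath n) : BasicPath n :=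
  ⟨carrierOutput (iotaDomino n).toFun (highestDomino n) p.1, by
    obtain ⟨h1, h2⟩ := outgoing_spec p
    filter_upwards [h2, p.2] with i h3 h4
    rw [carrierOutput, h3, h4]
    exact (iotaDominoFun_one _).1.trans h1⟩

/-- `T_∞(p)`: the path with which `T_ℓ(p)` agrees for all sufficiently large `ℓ`. -/
noncomputable def limitEvolution {n : ℕ} [n.AtLeastTwo] (p : BasicPath n) : BasicPath n :=
  @Classical.epsilon (BasicPath n) ⟨p⟩ fun q => ∀ᶠ ℓ in atTop, rowEvolution ℓ p = q

/-- `T_ℓ` for `ℓ` finite or infinite. -/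
noncomputable def evolution {n : ℕ} [n.AtLeastTwo] (ℓ : ℕ∞) (p : BasicPath n) : BasicPath n :=
  ENat.recTopCoe (limitEvolution p) (fun k => rowEvolution k p) ℓ

/-! ### The box-ball time evolution `T = K_2 ⋯ K_n` -/

theorem exists_empty_right {n : ℕ} [n.AtLeastTwo] (p : BasicPath n) (s : ℕ) :
    ∃ j, s < j ∧ p.1 j = letterOne n :=
  ((eventually_gt_atTop s).and p.2).exists

open Classical in
/-- The position of the nearest empty box to the right of position `s`. -/
noncomputable def nextEmpty {n : ℕ} [n.AtLeastTwo] (p : BasicPath n) (s : ℕ) : ℕ :=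
  Nat.find (exists_empty_right p s)

/-- Exchange the letter at position `s` with its nearest right `1`. -/
noncomputable def moveBall {n : ℕ} [n.AtLeastTwo] (p : BasicPath n) (s : ℕ) : BasicPath n :=
  ⟨fun j => p.1 (Equiv.swap s (nextEmpty p s) j), by
    filter_upwards [p.2, eventually_gt_atTop s, eventually_gt_atTop (nextEmpty p s)]
      with j h1 h2 h3
    rw [Equiv.swap_apply_of_ne_of_ne h2.ne' h3.ne']
    exact h1⟩

theorem finite_positions {n : ℕ} [n.AtLeastTwo] (p : BasicPath n) (a : Letter n) :
    {j | p.1 j = a ∧ a ≠ letterOne n}.Finite := by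
  obtain ⟨F, hF⟩ := eventually_atTop.1 p.2
  refine (Set.finite_lt_nat F).subset fun j hj => ?_
  by_contra hc
  exact hj.2 (hj.1.symm.trans (hF j (not_lt.1 hc)))

/-- The operator `K_a` (for `a ≠ 1`): from left to right, every letter `a` of `p` is moved
once, by exchanging it with its nearest right `1`. -/
noncomputable def moveColour {n : ℕ} [n.AtLeastTwo] (a : Letter n) (p : BasicPath n) :
    BasicPath n :=
  ((finite_positions p a).toFinset.sort (· ≤ ·)).foldl moveBall p

/-- The time evolution `T = K_2 ⋯ K_n`, in which `K_n` acts first. -/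
noncomputable def boxBall {n : ℕ} [n.AtLeastTwo] (p : BasicPath n) : BasicPath n :=
  ((Finset.univ.filter (· ≠ letterOne n)).sort (· ≤ ·)).foldr moveColour p

/-! ### Separation of the colour degree of freedom -/

/-- All letters of the path are `1` or `2`. -/
def IsMonochrome {n : ℕ} [n.AtLeastTwo] (p : BasicPath n) : Prop :=
  ∀ i, p.1 i = letterOne n ∨ p.1 i = letterTwo n

/-- The carrier `b_i = b((T_♮)^{N-i}(p))`, for `1 ≤ i ≤ N`. -/
noncomputable def decodedCarrier {n : ℕ} [n.AtLeastTwo] (N i : ℕ) (p : BasicPath n) : Domino n :=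
  outgoing (dominoEvolution^[N - i] p)

/-- The word `y_1 ⋯ y_N`, where `y_i` is the letter other than `1` in `b_i`. -/
noncomputable def colourWord {n : ℕ} [n.AtLeastTwo] (N : ℕ) (p : BasicPath n) :
    List (Letter n) :=
  (List.range N).map fun j => (decodedCarrier N (j + 1) p).1.2

/-- The relation `p = q ⊕ y`: with `N` the length of `y`, the path `q = (T_♮)^N(p)` has only
letters `1` and `2`, and `y` is the word of letters taken off. -/
def IsSeparation {n : ℕ} [n.AtLeastTwo] (p q : BasicPath n) (y : List (Letter n)) : Prop :=
  ∃ N, dominoEvolution^[N] p = q ∧ IsMonochrome q ∧ colourWord N p = y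

/-! The core is that `T_♮` commutes with `T_ℓ` and that `T_ℓ` does not change the outgoing carrier;
iterating both facts gives the separation. They come from the Yang–Baxter equation `Exchanged.step`:
if a domino and a row correspond to a row and a domino under the relation `Exchanged`, then a letter
sent through either pair comes out as the same letter, and the new states correspond again. Started
at the highest weight elements, this gives the commutation box by box
(`dominoEvolution_rowEvolution`). Far to the right both rows are `u_ℓ` again, so conservation of
letters identifies the outgoing dominoes (`outgoing_rowEvolution`).

Yang–Baxter is elementary because all the rules see only the cyclic order of the letters. Going up
cyclically from the incoming letter, a nonempty row emits the last of its letters that is met and a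
domino the first (`ejected_iff_cyc`, `iotaDominoFun_spec`). The linear order may therefore be cut at
the incoming letter; what remains is a comparison of a few integers.

That `T_♮` eventually produces a path in `1` and `2` follows from a lexicographic descent: first the
total weight of the balls, then the sum of the weights of the initial segments
(`exists_isMonochrome_aux`).

For large `ℓ` the row carrier never runs out of letters `1`. The number of letters `a` in it is then
the load of a carrier that performs `K_a` after the larger colours have moved (`foldr_moveColour`),
so `T_ℓ` equals `boxBall`. On any two given paths `T_∞` is thus a finite `T_ℓ`
(`exists_evolution_eq`), and the separation extends to `ℓ = ∞`. -/

/-! ### Cyclic order -/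

/-- Going up cyclically from `a` (included), with respect to the key `k`, one meets `b` strictly
before `c`. -/
def Cyc {A : Type} (k : A → ℕ) (a b c : A) : Prop :=
  (k a ≤ k b ∧ k b < k c) ∨ (k b < k c ∧ k c < k a) ∨ (k c < k a ∧ k a ≤ k b)

/-- The key of a letter for the linear order on the letters starting at `g`. -/
def rotKey {n : ℕ} (g z : Letter n) : ℕ := if z < g then z.1 + n else z.1

theorem rotKey_injective {n : ℕ} (g : Letter n) : Function.Injective (rotKey g) := by
  intro a b h
  have ha := a.2.1
  have hb := b.2.1
  have ha' := a.2.2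
  have hb' := b.2.2
  apply Subtype.ext
  simp only [rotKey, ← Subtype.coe_lt_coe] at h
  split_ifs at h <;> omega

theorem rotKey_self_le {n : ℕ} (g z : Letter n) : rotKey g g ≤ rotKey g z := by
  have hb := z.2.1
  have ha' := g.2.2
  simp only [rotKey, ← Subtype.coe_lt_coe]
  split_ifs <;> omega

/-- Cutting the circle of letters at another point rotates the linear order, which leaves cyclic
betweenness unchanged. This is what allows every comparison below to be made in the order starting
at the incoming letter. -/
theorem cyc_rotKey {n : ℕ} (g a b c : Letter n) :
    Cyc (rotKey g) a b c ↔ Cyc Subtype.val a b c := by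
  have ha := a.2.1
  have hb := b.2.1
  have hc := c.2.1
  have ha' := a.2.2
  have hb' := b.2.2
  have hc' := c.2.2
  have hg := g.2.1
  have hg' := g.2.2
  simp only [Cyc, rotKey, ← Subtype.coe_lt_coe]
  split_ifs <;> omega

/-- Going up from `β` and wrapping round, the last letter met is the largest one below `β`, or the
overall maximum if none is below: the two cases of the rule for `ι` are one cyclic rule. An empty
row has to be excluded, since it emits `β` itself. -/
theorem ejected_iff_cyc {n : ℕ} {x : Multiset (Letter n)} (hx : x ≠ 0) (β d : Letter n) :
    ejected x β = d ↔ d ∈ x ∧ ∀ z ∈ x, z ≠ d → Cyc Subtype.val β z d := by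
  have key : ∀ d, ejected x β = d → d ∈ x ∧ ∀ z ∈ x, z ≠ d → Cyc Subtype.val β z d := by
    rintro d rfl
    obtain ⟨y, hy⟩ := Multiset.exists_mem_of_ne_zero hx
    rcases ejected_spec x β with ⟨h1, h2, h3⟩ | ⟨h1, h2, h3⟩
    · refine ⟨h1, fun z hz hne => ?_⟩
      have h4 := h3 z hz
      have hne' : z.1 ≠ (ejected x β).1 := fun h => hne (Subtype.ext h)
      simp only [Cyc]
      simp only [← Subtype.coe_lt_coe, ← Subtype.coe_le_coe] at *
      omega
    · have hm : ejected x β ∈ x := by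
        rcases Multiset.mem_cons.1 h2 with h | h
        · have h5 := h3 y (Multiset.mem_cons_of_mem hy)
          rw [h] at h5 ⊢
          rwa [← le_antisymm h5 (h1 y hy)]
        · exact h
      refine ⟨hm, fun z hz hne => ?_⟩
      have h4 := h3 z (Multiset.mem_cons_of_mem hz)
      have h5 := h1 z hz
      have hne' : z.1 ≠ (ejected x β).1 := fun h => hne (Subtype.ext h)
      simp only [Cyc]
      simp only [← Subtype.coe_le_coe] at *
      omega
  refine ⟨key d, fun ⟨h1, h2⟩ => ?_⟩
  obtain ⟨h3, h4⟩ := key _ rfl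
  by_contra hne
  have h5 := h2 _ h3 hne
  have h6 := h4 _ h1 (Ne.symm hne)
  simp only [Cyc] at h5 h6
  omega

/-- The three cases of `ι'` are one cyclic rule, opposite to that of a row: the domino emits the
first of its letters met going up from `γ`. The letter `o` is the one that stays. -/
theorem iotaDominoFun_spec {n : ℕ} (b : Domino n) (γ : Letter n) :
    ∃ o, (((iotaDominoFun (b, γ)).1 = b.1.1 ∧ o = b.1.2) ∨
        ((iotaDominoFun (b, γ)).1 = b.1.2 ∧ o = b.1.1)) ∧
      Cyc Subtype.val γ (iotaDominoFun (b, γ)).1 o ∧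
      (((iotaDominoFun (b, γ)).2.1.1 = o ∧ (iotaDominoFun (b, γ)).2.1.2 = γ) ∨
        ((iotaDominoFun (b, γ)).2.1.1 = γ ∧ (iotaDominoFun (b, γ)).2.1.2 = o)) := by
  obtain ⟨⟨α, β⟩, h⟩ := b
  have h0 : α.1 < β.1 := h
  unfold iotaDominoFun
  simp only [← Subtype.coe_le_coe, ← Subtype.coe_lt_coe]
  split_ifs with h1 h2 h3
  · exact ⟨β, by simp, by simp only [Cyc]; omega, by simp⟩
  · exact ⟨α, by simp, by simp only [Cyc]; omega, by simp⟩
  · exact ⟨β, by simp, by simp only [Cyc]; omega, by simp⟩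
  · omega

/-! ### The exchange of a domino and a row -/

/-- The domino `{a, b}` and the row `x` are exchanged under `B_♮ ⊗ B_ℓ ≃ B_ℓ ⊗ B_♮`,
the new domino being `{u, v}`: either `u` and `v` are the letters of `x` following `a` and `b`
in the cyclic order, or these two coincide and only one letter of the domino changes. -/
def Exchange {A : Type} (k : A → ℕ) (a b : A) (x : Multiset A) (u v : A) : Prop :=
  (u ∈ x ∧ v ∈ x ∧ u ≠ v ∧ (∀ z ∈ x, z ≠ u → Cyc k z a u) ∧ ∀ z ∈ x, z ≠ v → Cyc k z b v) ∨
  (u = b ∧ v ∈ x ∧ (∀ z ∈ x, z ≠ v → Cyc k z b v) ∧ ∀ z ∈ x, Cyc k z a b)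

/-- `Exchange` for unordered pairs `{a, b}` and `{u, v}`. -/
def ExchangeSymm {A : Type} (k : A → ℕ) (a b : A) (x : Multiset A) (u v : A) : Prop :=
  Exchange k a b x u v ∨ Exchange k b a x u v ∨ Exchange k a b x v u ∨ Exchange k b a x v u

/-! ### One letter passing through exchanged states -/

section step

variable {A : Type} {k : A → ℕ} {a b u v r o q p γ s : A} {x x' : Multiset A}

theorem Exchange.mem_left (h : Exchange k a b x u v) (hc : a ::ₘ b ::ₘ x = u ::ₘ v ::ₘ x') :
    a ∈ x' := by
  rcases h with ⟨h1, h2, h3, -⟩ | ⟨rfl, h2, -⟩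
  · obtain ⟨y, rfl⟩ := Multiset.exists_cons_of_mem h1
    obtain ⟨y, rfl⟩ := Multiset.exists_cons_of_mem
      ((Multiset.mem_cons.1 h2).resolve_left (Ne.symm h3))
    have : x' = a ::ₘ b ::ₘ y := by
      rw [← Multiset.cons_inj_right v, ← Multiset.cons_inj_right u, ← hc]
      simp only [← Multiset.singleton_add]
      abel
    simp [this]
  · obtain ⟨y, rfl⟩ := Multiset.exists_cons_of_mem h2
    have : x' = a ::ₘ y := by
      rw [← Multiset.cons_inj_right v, ← Multiset.cons_inj_right u, ← hc]
      simp only [← Multiset.singleton_add]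
      abel
    simp [this]

theorem Exchange.mem_right (hc : a ::ₘ b ::ₘ x = u ::ₘ v ::ₘ x')
    (hu : u ∈ x ∧ u ≠ v) (hv : v ∈ x) (ha : ∀ z ∈ x, z ≠ u → Cyc k z a u)
    (hb : ∀ z ∈ x, z ≠ v → Cyc k z b v) : b ∈ x' := by
  refine Exchange.mem_left (k := k) (a := b) (b := a) (u := v) (v := u) (x := x)
    (Or.inl ⟨hv, hu.1, hu.2.symm, hb, ha⟩) ?_
  rw [Multiset.cons_swap b, hc, Multiset.cons_swap]

theorem Exchange.mem_of_mem (h : Exchange k a b x u v)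
    (hc : a ::ₘ b ::ₘ x = u ::ₘ v ::ₘ x') {z : A} (hz : z ∈ x') :
    z ∈ x ∨ z = a ∨ (z = b ∧ u ≠ b) := by
  rcases h with ⟨h1, h2, h3, -⟩ | ⟨rfl, h2, -⟩
  · have h : z ∈ a ::ₘ b ::ₘ x := by simp [hc, hz]
    simp only [Multiset.mem_cons] at h
    grind
  · rw [Multiset.cons_swap, Multiset.cons_inj_right] at hc
    have h : z ∈ a ::ₘ x := by simp [hc, hz]
    simp only [Multiset.mem_cons] at h
    tauto


/-- The letter left behind by the row, when it acts on the letter `q` left behind by the domino. -/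
theorem Exchange.output (hinj : Function.Injective k)
    (h : Exchange k a b x u v) (hab : a ≠ b) (hc : a ::ₘ b ::ₘ x = u ::ₘ v ::ₘ x')
    (hs : s ∈ x) (hmax : ∀ z ∈ x, k z ≤ k s)
    (hro : (r = a ∧ o = b) ∨ (r = b ∧ o = a)) (hr : Cyc k s r o)
    (hqp : (q = u ∧ p = v) ∨ (q = v ∧ p = u)) (hq : k q < k p) :
    r ∈ x' ∧ ∀ z ∈ x', z ≠ r → Cyc k q z r := by
  have hk : ∀ y z, y ≠ z → k y ≠ k z := fun y z h => hinj.ne h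
  have kab := hk _ _ hab
  have ha := h.mem_left hc
  have hm := fun z => h.mem_of_mem hc (z := z)
  rcases h with ⟨h1, h2, h3, h4, h5⟩ | ⟨rfl, h2, h3, h4⟩
  · have hb := Exchange.mem_right hc ⟨h1, h3⟩ h2 h4 h5
    clear hc
    refine ⟨by rcases hro with ⟨rfl, -⟩ | ⟨rfl, -⟩ <;> assumption, fun z hz hne => ?_⟩
    have kuv := hk _ _ h3
    have kzr := hk _ _ hne
    -- The quantified hypotheses are needed only at `u`, `v`, `s` and `z`; after that, everything is
    -- linear arithmetic on the keys.
    have e1 := hmax _ h1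
    have e2 := hmax _ h2
    have e3 := h5 u h1 h3
    have e4 := h4 v h2 h3.symm
    have e5 : z ∈ x → k z = k u ∨ Cyc k z a u := fun h => by
      by_cases hzu : z = u
      · exact Or.inl (hzu ▸ rfl)
      · exact Or.inr (h4 z h hzu)
    have e6 : z ∈ x → k z = k v ∨ Cyc k z b v := fun h => by
      by_cases hzu : z = v
      · exact Or.inl (hzu ▸ rfl)
      · exact Or.inr (h5 z h hzu)
    have e7 : k s = k u ∨ Cyc k s a u := by
      by_cases hzu : s = u
      · exact Or.inl (hzu ▸ rfl)
      · exact Or.inr (h4 s hs hzu)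
    have e8 : k s = k v ∨ Cyc k s b v := by
      by_cases hzu : s = v
      · exact Or.inl (hzu ▸ rfl)
      · exact Or.inr (h5 s hs hzu)
    have e9 := hmax z
    have e10 := hm z hz
    clear hmax h4 h5 hm
    simp only [Cyc] at *
    rcases hro with ⟨rfl, rfl⟩ | ⟨rfl, rfl⟩ <;> rcases hqp with ⟨rfl, rfl⟩ | ⟨rfl, rfl⟩ <;>
    rcases e10 with h | rfl | ⟨rfl, -⟩ <;>
    (try simp only [h, true_imp_iff] at *) <;> omega
  · have h7 := h4 s hs
    have h8 := hmax v h2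
    have h9 : k s = k v ∨ Cyc k s u v := by
      by_cases hzu : s = v
      · exact Or.inl (hzu ▸ rfl)
      · exact Or.inr (h3 s hs hzu)
    clear hc
    -- No letter of `x`, in particular not `s`, lies cyclically after `a` and up to `b`, so going up
    -- from `s` one meets `a` first.
    have hra : r = a ∧ o = u := by
      rcases hro with h | ⟨rfl, rfl⟩
      · exact h
      · simp only [Cyc] at *
        omega
    obtain ⟨rfl, rfl⟩ := hra
    refine ⟨ha, fun z hz hne => ?_⟩
    have hzx : z ∈ x := by
      rcases hm z hz with h | h | h
      · exact h
      · exact absurd h hne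
      · exact absurd rfl h.2
    have kzr := hk _ _ hne
    have e1 := hmax z hzx
    have e2 := h4 z hzx
    have e3 := h4 v h2
    have e4 : k z = k v ∨ Cyc k z o v := by
      by_cases hzu : z = v
      · exact Or.inl (hzu ▸ rfl)
      · exact Or.inr (h3 z hzx hzu)
    clear hmax h3 h4 hm
    simp only [Cyc] at *
    rcases hqp with ⟨rfl, rfl⟩ | ⟨rfl, rfl⟩ <;> omega

/-- After the row and the domino have both passed a smallest letter `γ`, the new states are again
exchanged. -/
theorem Exchange.next (hinj : Function.Injective k) (hγ : ∀ z, k γ ≤ k z)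
    (h : Exchange k a b x u v) (hab : a ≠ b)
    (hs : s ∈ x) (hmax : ∀ z ∈ x, k z ≤ k s)
    (hro : (r = a ∧ o = b) ∨ (r = b ∧ o = a)) (hr : Cyc k s r o)
    (hqp : (q = u ∧ p = v) ∨ (q = v ∧ p = u)) (hq : k q < k p) {x₁ : Multiset A}
    (hx₁ : s ::ₘ x₁ = γ ::ₘ x) : ExchangeSymm k o s x₁ p γ := by
  have hk : ∀ y z, y ≠ z → k y ≠ k z := fun y z h => hinj.ne h
  have kab := hk _ _ hab
  have hm : ∀ z, (z = s ∨ z ∈ x₁) ↔ (z = γ ∨ z ∈ x) := fun z => by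
    rw [← Multiset.mem_cons, ← Multiset.mem_cons, hx₁]
  have hγx : γ ∈ x₁ := by
    by_cases e : s = γ
    · subst e
      rwa [(Multiset.cons_inj_right s).1 hx₁]
    · exact ((hm γ).2 (Or.inl rfl)).resolve_left (Ne.symm e)
  clear hx₁
  have hpγ : p ≠ γ := by
    rintro rfl
    exact absurd (hγ q) (by omega)
  have hpγ' := hk _ _ hpγ
  have hle : ∀ z ∈ x₁, k z ≤ k s := fun z hz => by
    rcases (hm z).1 (Or.inr hz) with rfl | h
    · exact hγ s
    · exact hmax z h
  have hsγ : ∀ z ∈ x₁, z ≠ γ → Cyc k z s γ := fun z hz hne => by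
    have h1 := hγ z
    have h2 := hk _ _ hne
    have h3 := hle z hz
    simp only [Cyc]
    omega
  have hγs := hγ s
  have hγp := hγ p
  have hγo := hγ o
  -- If `p` lies in the old row, it is the letter following `o`, and `γ` follows the maximal key `s`
  -- by wrapping round. If not, `p` is a letter of the domino that was kept.
  by_cases hpx : p ∈ x
  · have hzp : ∀ z ∈ x₁, z ≠ p → Cyc k z o p := fun z hz hne => by
      have kzr := hk _ _ hne
      have hγz := hγ z
      have hmz := (hm z).1 (Or.inr hz)
      clear hsγ hle hγx hpγ
      rcases h with ⟨h1, h2, h3, h4, h5⟩ | ⟨rfl, h2, h3, h4⟩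
      · have kuv := hk _ _ h3
        have e1 := hmax _ h1
        have e2 := hmax _ h2
        have e3 := h5 u h1 h3
        have e4 := h4 v h2 h3.symm
        have e5 : z ∈ x → k z = k u ∨ Cyc k z a u := fun h => by
          by_cases hzu : z = u
          · exact Or.inl (hzu ▸ rfl)
          · exact Or.inr (h4 z h hzu)
        have e6 : z ∈ x → k z = k v ∨ Cyc k z b v := fun h => by
          by_cases hzu : z = v
          · exact Or.inl (hzu ▸ rfl)
          · exact Or.inr (h5 z h hzu)
        have e7 : k s = k u ∨ Cyc k s a u := by
          by_cases hzu : s = u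
          · exact Or.inl (hzu ▸ rfl)
          · exact Or.inr (h4 s hs hzu)
        have e8 : k s = k v ∨ Cyc k s b v := by
          by_cases hzu : s = v
          · exact Or.inl (hzu ▸ rfl)
          · exact Or.inr (h5 s hs hzu)
        have e9 := hmax z
        clear hmax h4 h5
        simp only [Cyc] at *
        rcases hro with ⟨rfl, rfl⟩ | ⟨rfl, rfl⟩ <;> rcases hqp with ⟨rfl, rfl⟩ | ⟨rfl, rfl⟩ <;>
        rcases hmz with rfl | h <;>
        (try simp only [h, true_imp_iff] at *) <;> omega
      · have e1 := h4 p hpx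
        have e2 := h4 s hs
        have e3 := h4 v h2
        have e4 := hmax v h2
        have e5 : k s = k v ∨ Cyc k s u v := by
          by_cases hzu : s = v
          · exact Or.inl (hzu ▸ rfl)
          · exact Or.inr (h3 s hs hzu)
        have e6 : z ∈ x → k z = k v ∨ Cyc k z u v := fun h => by
          by_cases hzu : z = v
          · exact Or.inl (hzu ▸ rfl)
          · exact Or.inr (h3 z h hzu)
        have e7 := h4 z
        have e8 := hmax z
        clear hmax h3 h4
        simp only [Cyc] at *
        rcases hro with ⟨rfl, rfl⟩ | ⟨rfl, rfl⟩ <;> rcases hqp with ⟨rfl, rfl⟩ | ⟨rfl, rfl⟩ <;>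
        rcases hmz with rfl | h <;>
        (try simp only [h, true_imp_iff] at *) <;> omega
    by_cases hp : p ∈ x₁
    · exact Or.inl (Or.inl ⟨hp, hγx, hpγ, hzp, hsγ⟩)
    -- Here the only copy of `p` has just left the row as `s`. No letter is left after `o` and up to
    -- `s`, so `s` is the letter kept by the domino.
    · have hps : p = s := ((hm p).2 (Or.inr hpx)).resolve_right hp
      subst hps
      exact Or.inl (Or.inr ⟨rfl, hγx, hsγ, fun z hz => hzp z hz (fun e => hp (e ▸ hz))⟩)
  · have hmem : ∀ z ∈ x₁, z = γ ∨ z ∈ x := fun z hz => (hm z).1 (Or.inr hz)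
    rcases h with ⟨h1, h2, -⟩ | ⟨rfl, h2, h3, h4⟩
    · rcases hqp with ⟨rfl, rfl⟩ | ⟨rfl, rfl⟩ <;> contradiction
    · obtain ⟨rfl, rfl⟩ : q = v ∧ p = u := by
        rcases hqp with ⟨rfl, rfl⟩ | h
        · contradiction
        · exact h
      have e1 := h4 s hs
      have e2 := h4 q h2
      have hro' : r = a ∧ o = p := by
        rcases hro with h | ⟨rfl, rfl⟩
        · exact h
        · clear hm hle hsγ hmem
          simp only [Cyc] at *
          omega
      obtain ⟨rfl, rfl⟩ := hro'
      have e0 : k s = k q ∨ Cyc k s o q := by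
        by_cases hzu : s = q
        · exact Or.inl (hzu ▸ rfl)
        · exact Or.inr (h3 s hs hzu)
      have key : ∀ z ∈ x₁, (z ≠ γ → Cyc k z o γ) ∧ Cyc k z s o := fun z hz => by
        have e3 := hle z hz
        have e4 := hγ z
        by_cases hzγ : z = γ
        · subst hzγ
          simp only [ne_eq, not_true_eq_false, false_imp_iff, true_and]
          clear hm hle hsγ
          simp only [Cyc] at *
          omega
        · have e5 := hk _ _ hzγ
          have e6 := h4 z ((hmem z hz).resolve_left hzγ)
          simp only [hzγ, ne_eq, not_false_eq_true, true_imp_iff]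
          clear hm hle hsγ
          simp only [Cyc] at *
          omega
      exact Or.inr (Or.inl (Or.inr ⟨rfl, hγx, fun z hz => (key z hz).1, fun z hz => (key z hz).2⟩))

end step

theorem exchangeSymm_rotKey {n : ℕ} (g : Letter n) {a b u v : Letter n} {x : Multiset (Letter n)} :
    ExchangeSymm (rotKey g) a b x u v ↔ ExchangeSymm Subtype.val a b x u v := by
  simp only [ExchangeSymm, Exchange, cyc_rotKey]

theorem exchangeSymm_swap {A : Type} {k : A → ℕ} {a b u v : A} {x : Multiset A}
    (h : ExchangeSymm k a b x u v) : ExchangeSymm k b a x u v := by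
  unfold ExchangeSymm at *
  tauto

theorem exchangeSymm_swap' {A : Type} {k : A → ℕ} {a b u v : A} {x : Multiset A}
    (h : ExchangeSymm k a b x u v) : ExchangeSymm k a b x v u := by
  unfold ExchangeSymm at *
  tauto

/-- The elements `d ⊗ x` of `B_♮ ⊗ B_ℓ` and `x' ⊗ d'` of `B_ℓ ⊗ B_♮` correspond to each other. -/
def Exchanged {n ℓ : ℕ} (d : Domino n) (x : Row n ℓ) (d' : Domino n) (x' : Row n ℓ) : Prop :=
  d.1.1 ::ₘ d.1.2 ::ₘ x.1 = d'.1.1 ::ₘ d'.1.2 ::ₘ x'.1 ∧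
    ExchangeSymm Subtype.val d.1.1 d.1.2 x.1 d'.1.1 d'.1.2

/-- The alternatives of `ExchangeSymm` differ only in the naming of the letters, so renaming leaves
a single oriented `Exchange`, read in the linear order that starts at any prescribed `g`. -/
theorem Exchanged.exists_exchange {n ℓ : ℕ} {d d' : Domino n} {x x' : Row n ℓ}
    (h : Exchanged d x d' x') (g : Letter n) : ∃ a b u v,
      ((a = d.1.1 ∧ b = d.1.2) ∨ (a = d.1.2 ∧ b = d.1.1)) ∧
      ((u = d'.1.1 ∧ v = d'.1.2) ∨ (u = d'.1.2 ∧ v = d'.1.1)) ∧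
      a ::ₘ b ::ₘ x.1 = u ::ₘ v ::ₘ x'.1 ∧ Exchange (rotKey g) a b x.1 u v := by
  obtain ⟨h1, h2⟩ := h
  have h3 := Multiset.cons_swap d.1.1 d.1.2 x.1
  have h4 := Multiset.cons_swap d'.1.1 d'.1.2 x'.1
  rcases (exchangeSymm_rotKey g).2 h2 with h | h | h | h
  · exact ⟨_, _, _, _, by simp, by simp, h1, h⟩
  · exact ⟨_, _, _, _, by simp, by simp, h3 ▸ h1, h⟩
  · exact ⟨_, _, _, _, by simp, by simp, h1.trans h4, h⟩
  · exact ⟨_, _, _, _, by simp, by simp, (h3 ▸ h1).trans h4, h⟩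

theorem iotaFun_cons {n ℓ : ℕ} (x : Row n ℓ) (γ : Letter n) :
    (iotaFun (x, γ)).1 ::ₘ (iotaFun (x, γ)).2.1 = γ ::ₘ x.1 :=
  Multiset.cons_erase (ejected_mem _ _)

theorem iotaDominoFun_cons {n : ℕ} (d : Domino n) (γ : Letter n) :
    ((iotaDominoFun (d, γ)).1 ::ₘ (iotaDominoFun (d, γ)).2.1.1 ::ₘ
      {(iotaDominoFun (d, γ)).2.1.2} : Multiset (Letter n)) = γ ::ₘ d.1.1 ::ₘ {d.1.2} := by
  obtain ⟨o, h1, -, h2⟩ := iotaDominoFun_spec d γ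
  rcases h1 with ⟨h, rfl⟩ | ⟨h, rfl⟩ <;> rcases h2 with ⟨h3, h4⟩ | ⟨h3, h4⟩ <;> rw [h, h3, h4] <;>
  · simp only [← Multiset.singleton_add]
    abel

/-- The Yang–Baxter equation in `B_♮ ⊗ B_ℓ ⊗ B_1`. -/
theorem Exchanged.step {n ℓ : ℕ} (hℓ : 1 ≤ ℓ) {d d' : Domino n} {x x' : Row n ℓ}
    (h : Exchanged d x d' x') (γ : Letter n) :
    (iotaDominoFun (d, (iotaFun (x, γ)).1)).1 = (iotaFun (x', (iotaDominoFun (d', γ)).1)).1 ∧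
    Exchanged (iotaDominoFun (d, (iotaFun (x, γ)).1)).2 (iotaFun (x, γ)).2
      (iotaDominoFun (d', γ)).2 (iotaFun (x', (iotaDominoFun (d', γ)).1)).2 := by
  obtain ⟨a, b, u, v, hd, hd', hc, he⟩ := h.exists_exchange γ
  have hne : ∀ y : Row n ℓ, y.1 ≠ 0 := fun y hy => by
    have := y.2
    rw [hy] at this
    simp at this
    omega
  obtain ⟨hs, hmax⟩ := (ejected_iff_cyc (hne x) γ _).1 (rfl : _ = (iotaFun (x, γ)).1)
  have cs := iotaFun_cons x γ
  obtain ⟨o, ho1, ho2, ho3⟩ := iotaDominoFun_spec d (iotaFun (x, γ)).1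
  obtain ⟨p, hp1, hp2, hp3⟩ := iotaDominoFun_spec d' γ
  have cr := iotaDominoFun_cons d (iotaFun (x, γ)).1
  have cq := iotaDominoFun_cons d' γ
  have cr' := iotaFun_cons x' (iotaDominoFun (d', γ)).1
  have hab : a ≠ b := by
    have := d.2
    rcases hd with ⟨rfl, rfl⟩ | ⟨rfl, rfl⟩
    · exact this.ne
    · exact this.ne'
  -- In the order starting at `γ`, the last letter met is simply the largest.
  have hm : ∀ z ∈ x.1, rotKey γ z ≤ rotKey γ (iotaFun (x, γ)).1 := fun z hz => by
    by_cases e : z = (iotaFun (x, γ)).1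
    · rw [← e]
    · have h1 := (cyc_rotKey γ _ _ _).2 (hmax z hz e)
      have h2 := rotKey_self_le γ z
      have h3 := rotKey_self_le γ (iotaFun (x, γ)).1
      simp only [Cyc] at h1
      omega
  have hro : ((iotaDominoFun (d, (iotaFun (x, γ)).1)).1 = a ∧ o = b) ∨
      ((iotaDominoFun (d, (iotaFun (x, γ)).1)).1 = b ∧ o = a) := by
    rcases hd with ⟨rfl, rfl⟩ | ⟨rfl, rfl⟩
    · exact ho1
    · exact ho1.symm
  have hqp : ((iotaDominoFun (d', γ)).1 = u ∧ p = v) ∨ ((iotaDominoFun (d', γ)).1 = v ∧ p = u) := by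
    rcases hd' with ⟨rfl, rfl⟩ | ⟨rfl, rfl⟩
    · exact hp1
    · exact hp1.symm
  have hq : rotKey γ (iotaDominoFun (d', γ)).1 < rotKey γ p := by
    have h1 := (cyc_rotKey γ _ _ _).2 hp2
    have h2 := rotKey_self_le γ p
    have h3 := rotKey_self_le γ (iotaDominoFun (d', γ)).1
    simp only [Cyc] at h1
    omega
  have ho2' := (cyc_rotKey γ _ _ _).2 ho2
  have out := he.output (rotKey_injective γ) hab hc hs hm hro ho2' hqp hq
  have nxt := he.next (rotKey_injective γ) (rotKey_self_le γ) hab hs hm hro ho2' hqp hq cs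
  simp only [cyc_rotKey, exchangeSymm_rotKey] at out nxt
  have hr : (iotaDominoFun (d, (iotaFun (x, γ)).1)).1 =
      (iotaFun (x', (iotaDominoFun (d', γ)).1)).1 :=
    ((ejected_iff_cyc (hne x') _ _).2 out).symm
  refine ⟨hr, ?_, ?_⟩
  · have hc0 := h.1
    generalize iotaFun (x, γ) = X at *
    generalize iotaDominoFun (d', γ) = D' at *
    generalize iotaDominoFun (d, X.1) = D at *
    generalize iotaFun (x', D'.1) = X' at *
    rw [← hr] at cr'
    -- Instead of subtracting multisets, the letters in transit are added to both sides; the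
    -- conservation laws of the four crossings then apply.
    rw [← Multiset.cons_inj_right D.1, ← Multiset.cons_inj_right X.1,
      ← Multiset.cons_inj_right D'.1]
    simp only [← Multiset.singleton_add] at *
    calc _ = {D'.1} + ({D.1} + ({D.2.1.1} + {D.2.1.2})) + ({X.1} + X.2.1) := by abel
      _ = ({d.1.1} + ({d.1.2} + x.1)) + {X.1} + {γ} + {D'.1} := by rw [cr, cs]; abel
      _ = ({γ} + ({d'.1.1} + {d'.1.2})) + ({D'.1} + x'.1) + {X.1} := by rw [hc0]; abel
      _ = _ := by rw [← cq, ← cr']; abel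
  · rcases ho3 with ⟨h1, h2⟩ | ⟨h1, h2⟩ <;> rcases hp3 with ⟨h3, h4⟩ | ⟨h3, h4⟩ <;>
      rw [h1, h2, h3, h4]
    · exact nxt
    · exact exchangeSymm_swap' nxt
    · exact exchangeSymm_swap nxt
    · exact exchangeSymm_swap (exchangeSymm_swap' nxt)

/-! ### Commutation of `T_♮` with `T_ℓ` -/

section commutation

variable {n : ℕ} [n.AtLeastTwo]

theorem exchanged_highest {ℓ : ℕ} (hℓ : 1 ≤ ℓ) :
    Exchanged (highestDomino n) (highestRow n ℓ) (highestDomino n) (highestRow n ℓ) := by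
  have hx : ∀ z ∈ (highestRow n ℓ).1, z = letterOne n := fun z hz => Multiset.eq_of_mem_replicate hz
  -- The domino keeps its `2`, and a `1` of the domino is traded for a `1` of the row.
  refine ⟨rfl, Or.inr (Or.inr (Or.inl (Or.inr ⟨rfl, ?_, ?_, ?_⟩)))⟩
  · exact Multiset.mem_replicate.2 ⟨by omega, rfl⟩
  · intro z hz hne
    exact absurd (hx z hz) hne
  · intro z hz
    rw [hx z hz]
    simp [Cyc, highestDomino, letterOne, letterTwo]

/-- The invariant compares the two orders of applying the carriers: row first and then domino on the
left, domino first and then row on the right. -/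
theorem exchanged_carrierState {ℓ : ℕ} (hℓ : 1 ≤ ℓ) (p : BasicPath n) (i : ℕ) :
    Exchanged
      (carrierState (iotaDomino n).toFun (highestDomino n) (rowEvolution ℓ p).1 i)
      (carrierState (iota n ℓ).toFun (highestRow n ℓ) p.1 i)
      (carrierState (iotaDomino n).toFun (highestDomino n) p.1 i)
      (carrierState (iota n ℓ).toFun (highestRow n ℓ) (dominoEvolution p).1 i) := by
  induction i with
  | zero => exact exchanged_highest hℓ
  | succ i ih => exact (ih.step hℓ (p.1 i)).2

theorem dominoEvolution_rowEvolution {ℓ : ℕ} (hℓ : 1 ≤ ℓ) (p : BasicPath n) :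
    dominoEvolution (rowEvolution ℓ p) = rowEvolution ℓ (dominoEvolution p) := by
  apply Subtype.ext
  funext i
  exact ((exchanged_carrierState hℓ p i).step hℓ (p.1 i)).1

theorem outgoing_rowEvolution {ℓ : ℕ} (hℓ : 1 ≤ ℓ) (p : BasicPath n) :
    outgoing (rowEvolution ℓ p) = outgoing p := by
  obtain ⟨h1, h2⟩ := outgoing_spec p
  obtain ⟨h3, h4⟩ := outgoing_spec (rowEvolution ℓ p)
  -- At a position where all four carriers are final, both rows are `u_ℓ` and both dominoes contain
  -- `1`; equality of contents leaves only the other letter to compare.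
  obtain ⟨i, e1, e2, e3, e4⟩ := (h2.and (h4.and ((rowCarrier_eventually ℓ p).and
    (rowCarrier_eventually ℓ (dominoEvolution p))))).exists
  have h := (exchanged_carrierState hℓ p i).1
  rw [e1, e2, e3, e4, h1, h3, Multiset.cons_inj_right, Multiset.cons_inj_left] at h
  exact Subtype.ext (Prod.ext (h3.trans h1.symm) h)

end commutation

/-! ### Reduction to a path in the letters `1` and `2` -/

section termination

variable {n : ℕ} [n.AtLeastTwo]

/-- The state of the carrier of `T_♮` just before the box `p i`. -/
def dominoState (p : BasicPath n) (i : ℕ) : Domino n :=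
  carrierState (iotaDomino n).toFun (highestDomino n) p.1 i

theorem dominoState_succ (p : BasicPath n) (i : ℕ) :
    dominoState p (i + 1) = (iotaDominoFun (dominoState p i, p.1 i)).2 := rfl

theorem dominoEvolution_apply (p : BasicPath n) (i : ℕ) :
    (dominoEvolution p).1 i = (iotaDominoFun (dominoState p i, p.1 i)).1 := rfl

theorem dominoState_cons (p : BasicPath n) (i : ℕ) :
    ((dominoEvolution p).1 i).1 + (dominoState p (i + 1)).1.1.1 + (dominoState p (i + 1)).1.2.1 =
      (p.1 i).1 + (dominoState p i).1.1.1 + (dominoState p i).1.2.1 := by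
  have h := congrArg (fun s => (s.map Subtype.val).sum) (iotaDominoFun_cons (dominoState p i) (p.1 i))
  simpa [dominoState_succ, dominoEvolution_apply, add_assoc] using h

theorem three_le_dominoState (p : BasicPath n) (i : ℕ) :
    3 ≤ (dominoState p i).1.1.1 + (dominoState p i).1.2.1 := by
  have h1 : (dominoState p i).1.1.1 < (dominoState p i).1.2.1 := (dominoState p i).2
  have h2 := (dominoState p i).1.1.2.1
  omega

/-- The total weight of the balls among the first `i` boxes. -/
def ballWeight (p : BasicPath n) (i : ℕ) : ℕ := ∑ j ∈ Finset.range i, ((p.1 j).1 - 1)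

/-- Each crossing conserves the sum of the letters, and `u_♮` has sum `3`. As `3` is the least sum
of a domino, no initial segment gains weight under `T_♮`. -/
theorem ballWeight_dominoEvolution (p : BasicPath n) (i : ℕ) :
    ballWeight (dominoEvolution p) i + (dominoState p i).1.1.1 + (dominoState p i).1.2.1 =
      ballWeight p i + 3 := by
  induction i with
  | zero => rfl
  | succ i ih =>
    have h := dominoState_cons p i
    have h1 := ((dominoEvolution p).1 i).2.1
    have h2 := (p.1 i).2.1
    unfold ballWeight at *
    rw [Finset.sum_range_succ, Finset.sum_range_succ]
    omega

/-- A domino of sum `3` is `{1, 2}`. It emits `1` or `2`, and by conservation the incoming letter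
equals the emitted one. -/
theorem letter_eq_of_dominoState (p : BasicPath n) (i : ℕ)
    (h : (dominoState p i).1.1.1 + (dominoState p i).1.2.1 = 3)
    (h' : (dominoState p (i + 1)).1.1.1 + (dominoState p (i + 1)).1.2.1 = 3) :
    p.1 i = letterOne n ∨ p.1 i = letterTwo n := by
  have h1 : (dominoState p i).1.1.1 < (dominoState p i).1.2.1 := (dominoState p i).2
  have h2 := (dominoState p i).1.1.2.1
  have h3 := dominoState_cons p i
  obtain ⟨o, h4, -⟩ := iotaDominoFun_spec (dominoState p i) (p.1 i)
  rw [← dominoEvolution_apply] at h4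
  have h5 : ((dominoEvolution p).1 i).1 = 1 ∨ ((dominoEvolution p).1 i).1 = 2 := by
    rcases h4 with ⟨h, -⟩ | ⟨h, -⟩ <;> rw [h] <;> omega
  rcases h5 with h | h
  · left
    apply Subtype.ext
    simp only [letterOne]
    omega
  · right
    apply Subtype.ext
    simp only [letterTwo]
    omega

theorem outgoing_eq_of_support (p : BasicPath n) (F : ℕ) (hF : ∀ i, F ≤ i → p.1 i = letterOne n) :
    (outgoing p).1.2 = (dominoState p F).1.2 := by
  have key : ∀ i, F ≤ i → (dominoState p i).1.2 = (dominoState p F).1.2 := by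
    intro i hi
    induction i, hi using Nat.le_induction with
    | base => rfl
    | succ i hi ih => rw [dominoState_succ, hF i hi, (iotaDominoFun_one _).2, ← ih]
  obtain ⟨i, h1, h2⟩ := ((outgoing_spec p).2.and (eventually_ge_atTop F)).exists
  rw [← key i h2, ← h1]
  rfl

theorem dominoEvolution_support (p : BasicPath n) (F : ℕ)
    (hF : ∀ i, F ≤ i → p.1 i = letterOne n) :
    ((dominoEvolution p).1 F = (dominoState p F).1.1) ∧
    (dominoState p (F + 1)).1 = (letterOne n, (outgoing p).1.2) ∧
    ∀ i, F + 1 ≤ i → (dominoEvolution p).1 i = letterOne n := by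
  have key : ∀ i, F ≤ i → (dominoState p (i + 1)).1.1 = letterOne n := by
    intro i hi
    rw [dominoState_succ, hF i hi, (iotaDominoFun_one _).2]
  have key' : ∀ i, F ≤ i → (dominoEvolution p).1 i = (dominoState p i).1.1 := by
    intro i hi
    rw [dominoEvolution_apply, hF i hi, (iotaDominoFun_one _).1]
  refine ⟨key' F le_rfl, Prod.ext (key F le_rfl) ?_, ?_⟩
  · rw [outgoing_eq_of_support p (F + 1) fun i hi => hF i (by omega)]
  · intro i hi
    rw [key' i (by omega)]
    obtain ⟨i, rfl⟩ : ∃ j, i = j + 1 := ⟨i - 1, by omega⟩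
    exact key i (by omega)

/-- If the carrier leaves with a letter `y > 2`, the total weight `S` drops by `y - 2`. If `y = 2`,
then `S` and the bound `F` on the support persist, and `W` drops unless every state up to `F` was
`{1, 2}`, in which case the path is already monochrome. The bound may grow when `S` drops, which is
why `S` is the outer induction. -/
theorem exists_isMonochrome_aux (S : ℕ) : ∀ (W F : ℕ) (p : BasicPath n),
    (∀ i, F ≤ i → p.1 i = letterOne n) → ballWeight p F = S →
    ∑ i ∈ Finset.range (F + 1), ballWeight p i = W →
    ∃ N, IsMonochrome (dominoEvolution^[N] p) := by
  induction S using Nat.strong_induction_on with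
  | _ S ihS =>
  intro W
  induction W using Nat.strong_induction_on with
  | _ W ihW =>
  intro F p hF hS hW
  obtain ⟨s1, s2, s3⟩ := dominoEvolution_support p F hF
  have hlt : letterOne n < (outgoing p).1.2 := by
    rw [← (outgoing_spec p).1]
    exact (outgoing p).2
  have hlt' : 1 < (outgoing p).1.2.1 := hlt
  have hle : ∀ i, ballWeight (dominoEvolution p) i ≤ ballWeight p i := fun i => by
    have h1 := ballWeight_dominoEvolution p i
    have h2 := three_le_dominoState p i
    omega
  by_cases hy : (outgoing p).1.2.1 = 2
  -- The smaller letter at `F` lies below `y = 2`; being `1`, it leaves box `F` empty and the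
  -- support does not grow.
  · have hst : (dominoState p F).1.1 = letterOne n := by
      have h1 := (dominoState p F).2
      rw [← outgoing_eq_of_support p F hF] at h1
      have h2 : (dominoState p F).1.1.1 < (outgoing p).1.2.1 := h1
      have h3 := (dominoState p F).1.1.2.1
      apply Subtype.ext
      simp only [letterOne]
      omega
    have hF' : ∀ i, F ≤ i → (dominoEvolution p).1 i = letterOne n := fun i hi => by
      rcases Nat.eq_or_lt_of_le hi with rfl | h
      · rw [s1, hst]
      · exact s3 i h
    have hw : ballWeight (dominoEvolution p) F = S := by
      have h1 := ballWeight_dominoEvolution p F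
      rw [hst, ← outgoing_eq_of_support p F hF, hy] at h1
      simp only [letterOne] at h1
      omega
    by_cases hall : ∀ i ∈ Finset.range (F + 1), ballWeight p i ≤ ballWeight (dominoEvolution p) i
    · refine ⟨0, fun i => ?_⟩
      rcases le_or_gt F i with h | h
      · exact Or.inl (hF i h)
      · have key : ∀ i ∈ Finset.range (F + 1),
            (dominoState p i).1.1.1 + (dominoState p i).1.2.1 = 3 := fun i hi => by
          have h1 := hall i hi
          have h2 := ballWeight_dominoEvolution p i
          have h3 := three_le_dominoState p i
          omega
        exact letter_eq_of_dominoState p i (key i (by simp; omega)) (key _ (by simp; omega))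
    · push Not at hall
      obtain ⟨N, hN⟩ := ihW _ (hW ▸ Finset.sum_lt_sum (fun i _ => hle i) hall) F
        (dominoEvolution p) hF' hw rfl
      exact ⟨N + 1, hN⟩
  · have hw : ballWeight (dominoEvolution p) (F + 1) < S := by
      have h1 := ballWeight_dominoEvolution p (F + 1)
      have h2 : ballWeight p (F + 1) = ballWeight p F := by
        unfold ballWeight
        rw [Finset.sum_range_succ, hF F le_rfl]
        rfl
      rw [s2] at h1
      simp only [letterOne] at h1
      omega
    obtain ⟨N, hN⟩ := ihS _ hw _ (F + 1) (dominoEvolution p) s3 rfl rfl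
    exact ⟨N + 1, hN⟩

theorem exists_isMonochrome (p : BasicPath n) : ∃ N, IsMonochrome (dominoEvolution^[N] p) := by
  obtain ⟨F, hF⟩ := eventually_atTop.1 p.2
  exact exists_isMonochrome_aux _ _ F p hF rfl rfl

/-- The carrier `{1, 2}` returns a `1` for a `1` and a `2` for a `2`, so it never changes. -/
theorem IsMonochrome.dominoEvolution_eq {p : BasicPath n} (hp : IsMonochrome p) :
    dominoEvolution p = p := by
  have step : ∀ i, iotaDominoFun (highestDomino n, p.1 i) = (p.1 i, highestDomino n) := by
    intro i
    have h12 : ¬ letterTwo n ≤ letterOne n := not_le.2 (highestDomino n).2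
    rcases hp i with h | h <;> rw [h] <;> simp [iotaDominoFun, highestDomino, h12]
  have key : ∀ i, dominoState p i = highestDomino n := by
    intro i
    induction i with
    | zero => rfl
    | succ i ih => rw [dominoState_succ, ih, step]
  apply Subtype.ext
  funext i
  rw [dominoEvolution_apply, key, step]

theorem IsMonochrome.rowEvolution {p : BasicPath n} (hp : IsMonochrome p) (ℓ : ℕ) :
    IsMonochrome (rowEvolution ℓ p) := by
  have key : ∀ i, ∀ z ∈ (carrierState (iota n ℓ).toFun (highestRow n ℓ) p.1 i).1,
      z = letterOne n ∨ z = letterTwo n := by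
    intro i
    induction i with
    | zero => exact fun z hz => Or.inl (Multiset.eq_of_mem_replicate hz)
    | succ i ih =>
      intro z hz
      rcases Multiset.mem_cons.1 (Multiset.mem_of_mem_erase hz) with rfl | h
      · exact hp i
      · exact ih z h
  intro i
  rcases Multiset.mem_cons.1 (ejected_mem
    (carrierState (iota n ℓ).toFun (highestRow n ℓ) p.1 i).1 (p.1 i)) with h | h
  · rw [show (_root_.rowEvolution ℓ p).1 i = p.1 i from h]
    exact hp i
  · exact key i _ h

end termination

/-! ### `T_∞` as the box-ball time evolution -/

section boxball

variable {n : ℕ} [n.AtLeastTwo]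

/-- The number of balls held just before the box `p i` by a carrier of balls that picks up the
balls at the positions of `L` and drops one ball into each empty box. -/
def heldBalls (L : List ℕ) (p : ℕ → Letter n) : ℕ → ℕ
  | 0 => 0
  | i + 1 => if i ∈ L then heldBalls L p i + 1
      else if p i = letterOne n then heldBalls L p i - 1 else heldBalls L p i

/-- The boxes left behind by the carrier that moves the balls `a` at the positions of `L`. -/
def carryBalls (a : Letter n) (L : List ℕ) (p : ℕ → Letter n) (i : ℕ) : Letter n :=
  if i ∈ L then letterOne n
  else if p i = letterOne n ∧ 0 < heldBalls L p i then a else p i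

theorem heldBalls_eq_zero {L : List ℕ} (p : ℕ → Letter n) {i : ℕ} (h : ∀ s ∈ L, i ≤ s) :
    heldBalls L p i = 0 := by
  induction i with
  | zero => rfl
  | succ i ih =>
    have h1 : i ∉ L := fun hi => absurd (h i hi) (by omega)
    rw [heldBalls, if_neg h1, ih fun s hs => (Nat.le_succ i).trans (h s hs)]
    simp

theorem nextEmpty_spec (p : BasicPath n) (s : ℕ) :
    s < nextEmpty p s ∧ p.1 (nextEmpty p s) = letterOne n ∧
      ∀ j, s < j → j < nextEmpty p s → p.1 j ≠ letterOne n := by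
  classical
  have h := Nat.find_spec (exists_empty_right p s)
  exact ⟨h.1, h.2, fun j h1 h2 h3 => Nat.find_min (exists_empty_right p s) h2 ⟨h1, h3⟩⟩

theorem moveBall_left (p : BasicPath n) (s : ℕ) : (moveBall p s).1 s = letterOne n := by
  simp [moveBall, (nextEmpty_spec p s).2.1]

theorem moveBall_right (p : BasicPath n) (s : ℕ) : (moveBall p s).1 (nextEmpty p s) = p.1 s := by
  simp [moveBall]

theorem moveBall_of_ne (p : BasicPath n) {s j : ℕ} (h1 : j ≠ s) (h2 : j ≠ nextEmpty p s) :
    (moveBall p s).1 j = p.1 j := by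
  simp [moveBall, Equiv.swap_apply_of_ne_of_ne h1 h2]

/-- Moving the ball at `s` beforehand removes one unit of load exactly on its way to `nextEmpty p
s`. There is no empty box strictly in between, so the truncated subtraction behaves alike on both
sides. -/
theorem heldBalls_cons {s : ℕ} {L : List ℕ} (p : BasicPath n) (hs : ∀ j ∈ L, s < j)
    (ht : nextEmpty p s ∉ L) (hps : p.1 s ≠ letterOne n) (i : ℕ) :
    heldBalls (s :: L) p.1 i = heldBalls L (moveBall p s).1 i +
      if s < i ∧ i ≤ nextEmpty p s then 1 else 0 := by
  obtain ⟨h1, h2, h3⟩ := nextEmpty_spec p s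
  have hsL : s ∉ L := fun h => lt_irrefl _ (hs s h)
  induction i with
  | zero => rfl
  | succ i ih =>
    simp only [heldBalls, List.mem_cons]
    rcases eq_or_ne i s with rfl | his
    · rw [if_pos (Or.inl rfl), ih, if_neg hsL, if_pos (moveBall_left p i),
        heldBalls_eq_zero _ fun j hj => (hs j hj).le, if_neg (by omega), if_pos (by omega)]
    · rcases eq_or_ne i (nextEmpty p s) with hit | hit
      · rw [hit] at ih ⊢
        rw [if_neg (by simp [ht, h1.ne']), if_pos h2, ih, if_neg ht, moveBall_right, if_neg hps,
          if_pos (by omega), if_neg (by omega)]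
        omega
      · rw [moveBall_of_ne p his hit, ih]
        simp only [his, false_or]
        by_cases hiL : i ∈ L
        · simp only [hiL, if_true]
          split_ifs <;> omega
        · simp only [hiL, if_false]
          by_cases hpi : p.1 i = letterOne n
          · have h4 : ¬ (s < i ∧ i < nextEmpty p s) := fun h => h3 i h.1 h.2 hpi
            rw [if_pos hpi, if_pos hpi]
            split_ifs <;> omega
          · rw [if_neg hpi, if_neg hpi]
            split_ifs <;> omega

/-- Balls of one colour are indistinguishable, so moving them one by one to the nearest empty box
fills the same boxes as a single carrier that drops a ball whenever it can. -/
theorem foldl_moveBall {a : Letter n} (ha : a ≠ letterOne n) (L : List ℕ) :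
    ∀ p : BasicPath n, L.Pairwise (· < ·) → (∀ s ∈ L, p.1 s = a) →
      (L.foldl moveBall p).1 = carryBalls a L p.1 := by
  induction L with
  | nil =>
    intro p _ _
    funext i
    simp only [List.foldl_nil, carryBalls, List.not_mem_nil, if_false]
    rw [heldBalls_eq_zero p.1 (by simp)]
    simp
  | cons s L ih =>
    intro p hL hp
    obtain ⟨hs, hL'⟩ := List.pairwise_cons.1 hL
    obtain ⟨h1, h2, h3⟩ := nextEmpty_spec p s
    have hps := hp s (by simp)
    have ht : nextEmpty p s ∉ L := fun h => ha ((hp _ (List.mem_cons_of_mem _ h)).symm.trans h2)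
    have hsL : s ∉ L := fun h => lt_irrefl _ (hs s h)
    have hne : p.1 s ≠ letterOne n := hps ▸ ha
    rw [List.foldl_cons, ih (moveBall p s) hL' fun j hj => by
      rw [moveBall_of_ne p (hs j hj).ne' fun h => ht (h ▸ hj), hp j (List.mem_cons_of_mem _ hj)]]
    funext i
    have hc := heldBalls_cons p hs ht hne i
    simp only [carryBalls, List.mem_cons, hc]
    rcases eq_or_ne i s with rfl | his
    · rw [if_neg hsL, if_pos (Or.inl rfl), moveBall_left,
        heldBalls_eq_zero _ fun j hj => (hs j hj).le]
      simp
    · rcases eq_or_ne i (nextEmpty p s) with hit | hit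
      · rw [hit, if_neg ht, moveBall_right, if_neg (by simp [hne]),
          if_neg (by simp [ht, h1.ne']), if_pos ⟨h2, by rw [if_pos (by omega)]; omega⟩, hps]
      · rw [moveBall_of_ne p his hit]
        simp only [his, false_or]
        by_cases hiL : i ∈ L
        · simp only [hiL, if_true]
        · simp only [hiL, if_false]
          by_cases hpi : p.1 i = letterOne n
          · have h4 : ¬ (s < i ∧ i < nextEmpty p s) := fun h => h3 i h.1 h.2 hpi
            rw [if_neg (by omega : ¬ (s < i ∧ i ≤ nextEmpty p s)), Nat.add_zero]
          · simp [hpi]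

/-- The number of balls `a` held by the carrier of `K_a` just before the box `p i`. -/
def colourCount (a : Letter n) (p : ℕ → Letter n) : ℕ → ℕ
  | 0 => 0
  | i + 1 => if p i = a then colourCount a p i + 1
      else if p i = letterOne n then colourCount a p i - 1 else colourCount a p i

theorem moveColour_apply {a : Letter n} (ha : a ≠ letterOne n) (p : BasicPath n) (i : ℕ) :
    (moveColour a p).1 i = if p.1 i = a then letterOne n
      else if p.1 i = letterOne n ∧ 0 < colourCount a p.1 i then a else p.1 i := by
  have hmem : ∀ j, j ∈ (finite_positions p a).toFinset.sort (· ≤ ·) ↔ p.1 j = a := fun j => by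
    simp [ha]
  have hcount : ∀ i, heldBalls ((finite_positions p a).toFinset.sort (· ≤ ·)) p.1 i =
      colourCount a p.1 i := by
    intro i
    induction i with
    | zero => rfl
    | succ i ih => simp only [heldBalls, colourCount, hmem, ih]
  unfold moveColour
  rw [foldl_moveBall ha _ p (Finset.sortedLT_sort _).pairwise fun s hs => (hmem s).1 hs]
  simp only [carryBalls, hmem, hcount]

/-- What becomes of a box `β`, met by the row carrier in state `x`, once only the balls with
letters in `L` have been moved. -/
def partialOutput (L : List (Letter n)) (x : Multiset (Letter n)) (β : Letter n) : Letter n :=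
  if β ≠ letterOne n ∧ β ∉ L then β
  else if ejected x β ∈ L then ejected x β else letterOne n

theorem ejected_lt {x : Multiset (Letter n)} {β : Letter n} (hx : letterOne n ∈ x)
    (hβ : β ≠ letterOne n) : ejected x β < β ∧ ∀ z ∈ x, z < β → z ≤ ejected x β := by
  rcases ejected_spec x β with h | h
  · exact h.2
  · exact absurd (le_antisymm (h.1 _ hx) (letterOne_le β)) hβ

theorem le_ejected_one {x : Multiset (Letter n)} :
    ∀ z ∈ x, z ≤ ejected x (letterOne n) := by
  rcases ejected_spec x (letterOne n) with h | h
  · exact absurd h.2.1 (not_lt.2 (letterOne_le _))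
  · exact fun z hz => h.2.2 z (Multiset.mem_cons_of_mem hz)

/-- With a `1` in the row, a ball `β` expels the largest letter below it, and an empty box expels
the maximum. Once the colours above `a` have moved, the box is thus empty exactly when `β` is `1` or
above `a` and no letter above `a` is expelled; an `a` in the row is then the letter expelled. So the
multiplicity of `a` follows the recursion of `colourCount`. -/
theorem partialOutput_cons {a : Letter n} {L : List (Letter n)} (ha : a ≠ letterOne n)
    (hL : ∀ z, z ∈ L ↔ a < z) {x : Multiset (Letter n)} (hx : letterOne n ∈ x) (β : Letter n) :
    (partialOutput (a :: L) x β = if partialOutput L x β = a then letterOne n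
      else if partialOutput L x β = letterOne n ∧ 0 < x.count a then a else partialOutput L x β) ∧
    ((β ::ₘ x).erase (ejected x β)).count a = if partialOutput L x β = a then x.count a + 1
      else if partialOutput L x β = letterOne n then x.count a - 1 else x.count a := by
  have ha1 : letterOne n < a := lt_of_le_of_ne (letterOne_le a) ha.symm
  have hcount : ((β ::ₘ x).erase (ejected x β)).count a + (if a = ejected x β then 1 else 0) =
      x.count a + if a = β then 1 else 0 := by
    rw [← Multiset.count_cons, ← Multiset.count_cons, Multiset.cons_erase (ejected_mem x β)]
  generalize ((β ::ₘ x).erase (ejected x β)).count a = c' at *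
  have hpos : 0 < x.count a ↔ a ∈ x := Multiset.count_pos
  have hmem := Multiset.mem_cons.1 (ejected_mem x β)
  simp only [partialOutput, List.mem_cons, hL]
  by_cases hβ : β = letterOne n
  · subst hβ
    have h1 := le_ejected_one (x := x)
    generalize ejected x (letterOne n) = e at *
    have h2 := h1 a
    grind
  · obtain ⟨h1, h2⟩ := ejected_lt hx hβ
    generalize ejected x β = e at *
    have h3 := h2 a
    grind

/-- The colours act in decreasing order: by `hup`, when `K_a` acts the colours already moved are
precisely those above `a`, as `partialOutput_cons` requires. -/
theorem foldr_moveColour (p : BasicPath n) (X : ℕ → Multiset (Letter n))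
    (h0 : ∀ z ∈ X 0, z = letterOne n)
    (hX : ∀ i, X (i + 1) = (p.1 i ::ₘ X i).erase (ejected (X i) (p.1 i)))
    (h1 : ∀ i, letterOne n ∈ X i) (L : List (Letter n)) (hL : L.Pairwise (· < ·))
    (hne : ∀ a ∈ L, a ≠ letterOne n) (hup : ∀ a ∈ L, ∀ z, a < z → z ∈ L) (i : ℕ) :
    (L.foldr moveColour p).1 i = partialOutput L (X i) (p.1 i) := by
  induction L generalizing i with
  | nil =>
    simp only [List.foldr_nil, partialOutput, List.not_mem_nil, not_false_eq_true, and_true,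
      if_false]
    split_ifs with h
    · rfl
    · exact not_not.1 h
  | cons a L ih =>
    obtain ⟨ha, hL'⟩ := List.pairwise_cons.1 hL
    have haL : ∀ z, z ∈ L ↔ a < z := fun z =>
      ⟨ha z, fun h => (List.mem_cons.1 (hup a (by simp) z h)).resolve_left h.ne'⟩
    have ih := ih hL' (fun b hb => hne b (List.mem_cons_of_mem _ hb))
      fun b hb z hz => (haL z).2 ((ha b hb).trans hz)
    have ha1 := hne a (by simp)
    have hcount : ∀ i, colourCount a (L.foldr moveColour p).1 i = (X i).count a := by
      intro i
      induction i with
      | zero => exact (Multiset.count_eq_zero.2 fun h => ha1 (h0 a h)).symm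
      | succ i ihi =>
        rw [colourCount, ihi, ih, hX, (partialOutput_cons ha1 haL (h1 i) (p.1 i)).2]
    rw [List.foldr_cons, moveColour_apply ha1, hcount, ih,
      (partialOutput_cons ha1 haL (h1 i) (p.1 i)).1]

/-- Each of the first `F` boxes costs the row at most one `1`, and afterwards an incoming `1` makes
up for any that leaves. -/
theorem count_one_rowCarrier (ℓ F : ℕ) (p : BasicPath n)
    (hF : ∀ i, F ≤ i → p.1 i = letterOne n) (i : ℕ) :
    ℓ ≤ (carrierState (iota n ℓ).toFun (highestRow n ℓ) p.1 i).1.count (letterOne n) +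
      min i F := by
  induction i with
  | zero => exact (Multiset.count_replicate_self (letterOne n) ℓ).ge.trans (Nat.le_add_right _ _)
  | succ i ih =>
    set x := carrierState (iota n ℓ).toFun (highestRow n ℓ) p.1 i
    have hc : (carrierState (iota n ℓ).toFun (highestRow n ℓ) p.1 (i + 1)).1 =
      (p.1 i ::ₘ x.1).erase (ejected x.1 (p.1 i)) := rfl
    have h := congrArg (Multiset.count (letterOne n))
      (Multiset.cons_erase (ejected_mem x.1 (p.1 i)))
    rw [Multiset.count_cons, Multiset.count_cons, ← hc] at h
    rcases lt_or_ge i F with hi | hi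
    · have h2 : min (i + 1) F = min i F + 1 := by omega
      split_ifs at h <;> omega
    · rw [if_pos (hF i hi).symm] at h
      split_ifs at h <;> omega

theorem rowEvolution_eq_boxBall (p : BasicPath n) {ℓ F : ℕ}
    (hF : ∀ i, F ≤ i → p.1 i = letterOne n) (hℓ : F < ℓ) : rowEvolution ℓ p = boxBall p := by
  have h1 : ∀ i, letterOne n ∈ (carrierState (iota n ℓ).toFun (highestRow n ℓ) p.1 i).1 := by
    intro i
    have := count_one_rowCarrier ℓ F p hF i
    rw [← Multiset.count_pos]
    omega
  have hmem : ∀ a : Letter n, a ∈ (Finset.univ.filter (· ≠ letterOne n)).sort (· ≤ ·) ↔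
      a ≠ letterOne n := fun a => by simp
  apply Subtype.ext
  funext i
  rw [boxBall, foldr_moveColour p
    (fun i => (carrierState (iota n ℓ).toFun (highestRow n ℓ) p.1 i).1)
    (fun z hz => Multiset.eq_of_mem_replicate hz) (fun i => rfl) h1 _
    (Finset.sortedLT_sort _).pairwise (fun a ha => (hmem a).1 ha)
    (fun a ha z hz => (hmem z).2 (((letterOne_le a).trans_lt hz).ne'))]
  change ejected _ _ = _
  simp only [partialOutput, hmem]
  split_ifs with h2 h3
  · exact absurd h2 (by simp)
  · rfl
  · exact not_not.1 h3

theorem eventually_rowEvolution (p : BasicPath n) : ∀ᶠ ℓ in atTop, rowEvolution ℓ p = boxBall p := by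
  obtain ⟨F, hF⟩ := eventually_atTop.1 p.2
  filter_upwards [eventually_gt_atTop F] with ℓ hℓ
  exact rowEvolution_eq_boxBall p hF hℓ

theorem limitEvolution_eq_boxBall (p : BasicPath n) : limitEvolution p = boxBall p := by
  -- Since a stable value exists, the choice operator returns one, and two eventual values coincide.
  have h := Classical.epsilon_spec (p := fun q => ∀ᶠ ℓ in atTop, rowEvolution ℓ p = q)
    ⟨_, eventually_rowEvolution p⟩
  obtain ⟨ℓ, h1, h2⟩ := (h.and (eventually_rowEvolution p)).exists
  exact h1.symm.trans h2

/-- On finitely many paths, `T_ℓ` is given by one finite carrier, also for `ℓ = ∞`. -/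
theorem exists_evolution_eq {ℓ : ℕ∞} (hℓ : 1 ≤ ℓ) (p q : BasicPath n) :
    ∃ k : ℕ, 1 ≤ k ∧ evolution ℓ p = rowEvolution k p ∧ evolution ℓ q = rowEvolution k q := by
  induction ℓ using ENat.recTopCoe with
  | top =>
    obtain ⟨k, h1, h2, h3⟩ := ((eventually_ge_atTop 1).and
      ((eventually_rowEvolution p).and (eventually_rowEvolution q))).exists
    exact ⟨k, h1, (limitEvolution_eq_boxBall p).trans h2.symm,
      (limitEvolution_eq_boxBall q).trans h3.symm⟩
  | coe k => exact ⟨k, by exact_mod_cast hℓ, rfl, rfl⟩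

end boxball

/-! ### Separation for all `ℓ`, including `ℓ = ∞` -/

section main

variable {n : ℕ} [n.AtLeastTwo]

theorem dominoEvolution_evolution {ℓ : ℕ∞} (hℓ : 1 ≤ ℓ) (p : BasicPath n) :
    dominoEvolution (evolution ℓ p) = evolution ℓ (dominoEvolution p) := by
  obtain ⟨k, hk, h1, h2⟩ := exists_evolution_eq hℓ p (dominoEvolution p)
  rw [h1, h2, dominoEvolution_rowEvolution hk]

theorem iterate_dominoEvolution_evolution {ℓ : ℕ∞} (hℓ : 1 ≤ ℓ) (N : ℕ) (p : BasicPath n) :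
    dominoEvolution^[N] (evolution ℓ p) = evolution ℓ (dominoEvolution^[N] p) :=
  Function.Commute.iterate_left (fun p => dominoEvolution_evolution hℓ p) N p

theorem outgoing_evolution {ℓ : ℕ∞} (hℓ : 1 ≤ ℓ) (p : BasicPath n) :
    outgoing (evolution ℓ p) = outgoing p := by
  obtain ⟨k, hk, h1, -⟩ := exists_evolution_eq hℓ p p
  rw [h1, outgoing_rowEvolution hk]

theorem IsMonochrome.evolution {ℓ : ℕ∞} (hℓ : 1 ≤ ℓ) {p : BasicPath n} (hp : IsMonochrome p) :
    IsMonochrome (evolution ℓ p) := by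
  obtain ⟨k, -, h1, -⟩ := exists_evolution_eq hℓ p p
  rw [h1]
  exact hp.rowEvolution k

theorem decodedCarrier_evolution {ℓ : ℕ∞} (hℓ : 1 ≤ ℓ) (N i : ℕ) (p : BasicPath n) :
    decodedCarrier N i (evolution ℓ p) = decodedCarrier N i p := by
  rw [decodedCarrier, iterate_dominoEvolution_evolution hℓ, outgoing_evolution hℓ, decodedCarrier]

theorem iterate_eq_of_isMonochrome {p : BasicPath n} {N M : ℕ} (hNM : N ≤ M)
    (hN : IsMonochrome (dominoEvolution^[N] p)) :
    dominoEvolution^[M] p = dominoEvolution^[N] p := by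
  obtain ⟨k, rfl⟩ := Nat.exists_eq_add_of_le' hNM
  rw [Function.iterate_add_apply, Function.iterate_fixed hN.dominoEvolution_eq]

end main

theorem mainTheorem1 (n : ℕ) [n.AtLeastTwo] :
    -- a suitable `N` exists, and the reduced path does not depend on it
    (∀ (ℓ : ℕ∞), 1 ≤ ℓ → ∀ p : BasicPath n, ∃ N : ℕ,
      IsMonochrome (dominoEvolution^[N] p) ∧
      IsMonochrome (dominoEvolution^[N] (evolution ℓ p))) ∧
    (∀ (p : BasicPath n) (N M : ℕ), IsMonochrome (dominoEvolution^[N] p) →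
      IsMonochrome (dominoEvolution^[M] p) → dominoEvolution^[N] p = dominoEvolution^[M] p) ∧
    -- separation of the colours for every `ℓ`, including `ℓ = ∞`
    (∀ (ℓ : ℕ∞), 1 ≤ ℓ → ∀ (p : BasicPath n) (N : ℕ),
      IsMonochrome (dominoEvolution^[N] p) →
      IsMonochrome (dominoEvolution^[N] (evolution ℓ p)) →
      evolution ℓ (dominoEvolution^[N] p) = dominoEvolution^[N] (evolution ℓ p) ∧
      (∀ i ∈ Finset.Icc 1 N, decodedCarrier N i p = decodedCarrier N i (evolution ℓ p)) ∧
      IsSeparation p (dominoEvolution^[N] p) (colourWord N p) ∧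
      IsSeparation (evolution ℓ p) (evolution ℓ (dominoEvolution^[N] p)) (colourWord N p)) ∧
    -- `T_∞` is the stable value of `T_ℓ` and equals the box-ball time evolution
    (∀ p : BasicPath n, (∀ᶠ ℓ : ℕ in atTop, evolution (ℓ : ℕ∞) p = evolution ⊤ p) ∧
      evolution ⊤ p = boxBall p) := by
  refine ⟨fun ℓ hℓ p => ?_, fun p N M hN hM => ?_, fun ℓ hℓ p N hN hN' => ?_, fun p => ?_⟩
  · obtain ⟨N, hN⟩ := exists_isMonochrome p
    refine ⟨N, hN, ?_⟩
    rw [iterate_dominoEvolution_evolution hℓ]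
    -- An `N` that works for `p` also works for `T_ℓ(p)`, because `T_ℓ` introduces no new letters.
    exact hN.evolution hℓ
  · rcases le_total N M with h | h
    · exact (iterate_eq_of_isMonochrome h hN).symm
    · exact iterate_eq_of_isMonochrome h hM
  · have hc := iterate_dominoEvolution_evolution hℓ N p
    refine ⟨hc.symm, fun i _ => (decodedCarrier_evolution hℓ N i p).symm,
      ⟨N, rfl, hN, rfl⟩, N, hc, hc ▸ hN', ?_⟩
    simp only [colourWord, decodedCarrier_evolution hℓ]
  · have h := limitEvolution_eq_boxBall p
    refine ⟨?_, h⟩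
    filter_upwards [eventually_rowEvolution p] with ℓ hℓ
    exact hℓ.trans h.symm
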